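/- Let $I=[0,1]$ and let $\tau:I\to I$ be piecewise monotonic: there are points $0=a_0<a_1<\dots<a_n=1$ such that $\tau$ is continuous and strictly monotonic on each $(a_{i-1},a_i)$. Fix such a partition (not necessarily maximal) and put $C=\{a_0,\dots,a_n\}$. For $x\in I$ let $\widehat\tau(x)$ be the set of left and right limits of $\tau$ at $x$, and put $\widehat\tau(S)=\bigcup_{x\in S}\widehat\tau(x)$ and $\widehat\tau^{-1}(S)=\{x:\widehat\tau(x)\cap S\neq\emptyset\}$ for $S\subset I$. Let $I_1$ be the smallest subset of $I$ that contains $C$ and is closed under $\widehat\tau$ and $\widehat\tau^{-1}$. The values of $\tau$ at the points of $C$ are disregarded: in images $\tau(S)$ and in monotonicity on intervals below, $\tau$ is viewed as undefined on $C$. Assume that $\tau$ is Markov, with Markov partition $0=b_0<b_1<\dots<b_q=1$: each $b_i$ lies in $I_1$; on each $E_i=(b_{i-1},b_i)$ the map $\tau$ is monotonic; each $\overline{\tau(E_i)}$ is a union of intervals $[b_{j-1},b_j]$; and $\widehat\tau^k(C)\subset\{b_0,\dots,b_q\}$ for some $k\ge 0$. Assume also that $\tau$ is piecewise linear: on each $E_i$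 it is piecewise linear, all pieces in $E_i$ having the same slope (the slope may depend on $i$, and $\tau$ need not be continuous on $E_i$). Let $A$ be the incidence matrix, i.e. the $q\times q$ zero-one matrix with $A_{ij}=1$ iff $\widehat\tau(E_i)\supset E_j$. Call $\tau$ topologically exact if for every nonempty open $V\subset I$ there is $m\ge 0$ with $\widehat\tau^m(V)=I$, and transitive if for all nonempty open $U,V\subset I$ there is $m\ge 0$ with $\tau^m(U)\cap V\neq\emptyset$ ($\tau$ being undefined on $C$). The matrix $A$ is primitive if some power $A^m$, $m\ge 1$, has strictly positive entries, and irreducible if in the directed graph with an edge $i\to j$ whenever $A_{ij}=1$ there is a path of length at least one from every vertex to every vertex. Let $X$ be the totally ordered set obtained from $I$ by replacing each $x\in I_1\setminus\{0,1\}$ by two points $x^-<x^+$, with the order topology, and let $\pi:X\to I$ be the collapse map. The local homeomorphism associated with $\tau$ is the unique continuous map $\sigma:X\to X$ with $\pi\circ\sigma=\tau\circ\pi$ on $\pi^{-1}(I\setminus I_1)$. Let $X_A$ be the space of sequences $(x_k)_{k\ge 0}$ in $\{1,\dots,q\}$ with $A_{x_kx_{k+1}}=1$ for all $k$, with the product topology,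 and let $\sigma_A$ be the left shift on $X_A$. Then: 1. If $q\ge 2$, then $\tau$ is topologically exact if and only if $A$ is primitive. 2. $\tau$ is transitive if and only if $A$ is irreducible and is not a permutation matrix. 3. If $A$ is irreducible and is not a permutation matrix, then the associated map $\sigma$ exists and is unique, and $(X,\sigma)$ is conjugate to $(X_A,\sigma_A)$, i.e. there is a homeomorphism $h:X\to X_A$ with $h\circ\sigma=\sigma_A\circ h$. -/

import Mathlib

open Set Filter Topology

namespace IntervalMap

/-- `τ : [0,1] → [0,1]` is piecewise monotonic with associated partition
`0 = a 0 < a 1 < ⋯ < a n = 1`.  The partition need not be maximal. -/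
structure IsPiecewiseMonotonic (τ : unitInterval → unitInterval) {n : ℕ}
    (a : Fin (n + 1) → unitInterval) : Prop where
  strictMono : StrictMono a
  first : a 0 = 0
  last : a (Fin.last n) = 1
  continuousOn : ∀ i : Fin n, ContinuousOn τ (Ioo (a i.castSucc) (a i.succ))
  monotonic : ∀ i : Fin n, StrictMonoOn τ (Ioo (a i.castSucc) (a i.succ)) ∨
    StrictAntiOn τ (Ioo (a i.castSucc) (a i.succ))

/-- The multivalued map `τ̂`: `hat τ x` is the set of left and right limits of `τ` at `x`
(only the right limit at `0`, only the left limit at `1`). -/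
def hat (τ : unitInterval → unitInterval) (x : unitInterval) : Set unitInterval :=
  {y | (0 < x ∧ Tendsto τ (𝓝[<] x) (𝓝 y)) ∨ (x < 1 ∧ Tendsto τ (𝓝[>] x) (𝓝 y))}

/-- The image `τ̂(U) = ⋃ x ∈ U, τ̂(x)`. -/
def hatImage (τ : unitInterval → unitInterval) (U : Set unitInterval) : Set unitInterval :=
  ⋃ x ∈ U, hat τ x

/-- The image of `U` when `τ` is viewed as undefined on `C`. -/
def partialImage (τ : unitInterval → unitInterval) (C U : Set unitInterval) :
    Set unitInterval :=
  τ '' (U \ C)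

/-- Membership in the generalized orbit of `C`, the smallest set containing `C` and closed under
`τ̂` and `τ̂⁻¹`, where `τ̂⁻¹(S) = {x | τ̂(x) ∩ S ≠ ∅}`. -/
inductive InGeneralizedOrbit (τ : unitInterval → unitInterval) (C : Set unitInterval) :
    unitInterval → Prop
  | base {x : unitInterval} (hx : x ∈ C) : InGeneralizedOrbit τ C x
  | image {x y : unitInterval} (hx : InGeneralizedOrbit τ C x) (hy : y ∈ hat τ x) :
      InGeneralizedOrbit τ C y
  | preimage {x y : unitInterval} (hy : InGeneralizedOrbit τ C y) (hxy : y ∈ hat τ x) :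
      InGeneralizedOrbit τ C x

/-- The generalized orbit of `C`. -/
def generalizedOrbit (τ : unitInterval → unitInterval) (C : Set unitInterval) :
    Set unitInterval :=
  {x | InGeneralizedOrbit τ C x}

/-- `τ` is topologically exact: for every nonempty open `V` some `τ̂ⁿ(V)` is all of `[0,1]`. -/
def IsTopologicallyExact (τ : unitInterval → unitInterval) : Prop :=
  ∀ V : Set unitInterval, IsOpen V → V.Nonempty → ∃ n : ℕ, (hatImage τ)^[n] V = univ

/-- `τ`, viewed as undefined on `C`, is transitive: for all nonempty open `U` and `V` there is
`n ≥ 0` such that `τⁿ(U)` meets `V`. -/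
def IsTransitive (τ : unitInterval → unitInterval) (C : Set unitInterval) : Prop :=
  ∀ U V : Set unitInterval, IsOpen U → U.Nonempty → IsOpen V → V.Nonempty →
    ∃ n : ℕ, ((partialImage τ C)^[n] U ∩ V).Nonempty

/-- `0 = b 0 < ⋯ < b q = 1` is a Markov partition for the piecewise monotonic map `τ` whose
associated partition has the endpoints `C`.  The values of `τ` on `C` play no role. -/
structure IsMarkovPartition (τ : unitInterval → unitInterval) (C : Set unitInterval) {q : ℕ}
    (b : Fin (q + 1) → unitInterval) : Prop where
  strictMono : StrictMono b
  first : b 0 = 0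
  last : b (Fin.last q) = 1
  mem_orbit : ∀ i, b i ∈ generalizedOrbit τ C
  monotonic : ∀ i : Fin q, MonotoneOn τ (Ioo (b i.castSucc) (b i.succ) \ C) ∨
    AntitoneOn τ (Ioo (b i.castSucc) (b i.succ) \ C)
  closure_image : ∀ i : Fin q, ∃ S : Set (Fin q),
    closure (partialImage τ C (Ioo (b i.castSucc) (b i.succ))) =
      ⋃ j ∈ S, Icc (b j.castSucc) (b j.succ)
  eventually_mem : ∃ k : ℕ, (hatImage τ)^[k] C ⊆ range b

/-- `τ` is piecewise linear with respect to the Markov partition `b`: on each Markov interval all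
the pieces of `τ` are affine with a common slope `m`, which may depend on the Markov interval.
Jumps at points of the partition `a` inside a Markov interval are allowed. -/
def IsPiecewiseLinear (τ : unitInterval → unitInterval) {n q : ℕ}
    (a : Fin (n + 1) → unitInterval) (b : Fin (q + 1) → unitInterval) : Prop :=
  ∀ i : Fin q, ∃ m : ℝ, ∀ j : Fin n, ∃ d : ℝ,
    ∀ x ∈ Ioo (b i.castSucc) (b i.succ) ∩ Ioo (a j.castSucc) (a j.succ),
      (τ x : ℝ) = m * (x : ℝ) + d

open Classical in
/-- The zero-one incidence matrix of the Markov partition `b`: the `(i, j)` entry is `1` iff the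
image of the `i`-th open partition interval contains the `j`-th one. -/
noncomputable def incidenceMatrix (τ : unitInterval → unitInterval) {q : ℕ}
    (b : Fin (q + 1) → unitInterval) : Matrix (Fin q) (Fin q) ℤ :=
  Matrix.of fun i j =>
    if Ioo (b j.castSucc) (b j.succ) ⊆ hatImage τ (Ioo (b i.castSucc) (b i.succ)) then 1 else 0

/-- `A` is a permutation matrix. -/
def IsPermutationMatrix {q : ℕ} (A : Matrix (Fin q) (Fin q) ℤ) : Prop :=
  ∃ p : Equiv.Perm (Fin q), A = p.permMatrix ℤ

/-- The disconnection of `[0,1]` at the points of `S`: each point `x` of `S \ {0,1}` is replaced by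
two points `x⁻ < x⁺`, here `(x, false)` and `(x, true)`; every other point `x` stays a single
point `(x, false)`.  The order is lexicographic. -/
def Disconnection (S : Set unitInterval) : Type :=
  {p : unitInterval ×ₗ Bool // (ofLex p).2 = true → (ofLex p).1 ∈ S \ {0, 1}}

noncomputable instance (S : Set unitInterval) : LinearOrder (Disconnection S) :=
  inferInstanceAs (LinearOrder
    {p : unitInterval ×ₗ Bool // (ofLex p).2 = true → (ofLex p).1 ∈ S \ {0, 1}})

noncomputable instance (S : Set unitInterval) : TopologicalSpace (Disconnection S) :=
  Preorder.topology (Disconnection S)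

instance (S : Set unitInterval) : OrderTopology (Disconnection S) :=
  ⟨rfl⟩

/-- The collapse map `π : X → [0,1]`. -/
def collapse {S : Set unitInterval} (x : Disconnection S) : unitInterval :=
  (ofLex x.1).1

/-- The space `X` on which the local homeomorphism associated with `τ` acts: the disconnection of
`[0,1]` at the generalized orbit of `C`. -/
abbrev DisconnectedSpace (τ : unitInterval → unitInterval) (C : Set unitInterval) : Type :=
  Disconnection (generalizedOrbit τ C)

/-- `σ` is a continuous self-map of `X` with `π ∘ σ = τ ∘ π` over the complement of the generalized
orbit.  The local homeomorphism associated with `τ` is the unique map with this property. -/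
def IsAssociatedMap (τ : unitInterval → unitInterval) (C : Set unitInterval)
    (σ : DisconnectedSpace τ C → DisconnectedSpace τ C) : Prop :=
  Continuous σ ∧
    ∀ x : DisconnectedSpace τ C, collapse x ∉ generalizedOrbit τ C →
      collapse (σ x) = τ (collapse x)

/-- The one-sided shift space `X_A`, with the product topology. -/
abbrev ShiftSpace {q : ℕ} (A : Matrix (Fin q) (Fin q) ℤ) : Type :=
  {x : ℕ → Fin q // ∀ k, A (x k) (x (k + 1)) = 1}

/-- The left shift `σ_A` on `X_A`. -/
def shift {q : ℕ} (A : Matrix (Fin q) (Fin q) ℤ) (x : ShiftSpace A) : ShiftSpace A :=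
  ⟨fun k => x.1 (k + 1), fun k => x.2 (k + 1)⟩

/-- `(X, f)` and `(Y, g)` are (topologically) conjugate. -/
def AreConjugate {X Y : Type*} [TopologicalSpace X] [TopologicalSpace Y]
    (f : X → X) (g : Y → Y) : Prop :=
  ∃ h : X ≃ₜ Y, ∀ x, h (f x) = g (h x)

end IntervalMap

namespace IntervalMap

/-! Inside a Markov interval all pieces have one slope and, by monotonicity, the jumps go in the
direction of that slope. A jump therefore skips a gap in the image. As the closure of the image is a
union of Markov intervals, no gap can fall inside a covered `E_j`, so `E_j` is hit by a single
affine branch `x ↦ m i * x + d i j` whose preimage of the closed interval stays inside the closed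
`E_i` (`exists_affine_branch`, `exists_slope`). These branches form an `IsBranchSystem`, and the
rest of the argument uses nothing else about `τ`.

An admissible word determines a cylinder: a closed interval carried affinely onto the closed Markov
interval of its last letter. Prolonging the word never lengthens the cylinder, and shortens it by a
uniform factor at each vertex with two successors (`exists_contraction`). If `A` is irreducible and
not a permutation matrix, every path meets such vertices infinitely often
(`branching_of_isIrreducible`), so cylinders shrink to points (`exists_cylinder_small`). Hence every
open set contains a cylinder and some iterate of it covers a Markov interval; powers of `A` then
give exactness or transitivity. Conversely, these properties are read off on the Markov intervals,
and a permutation matrix is excluded because the points close to the ends of the intervals would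
form an invariant set.

For the conjugacy, an admissible sequence goes to the only point in all its cylinders, lifted to the
right-hand copy when that point is the left end of some cylinder. This gives a continuous injection
of the compact space `X_A` into `X` with dense image, hence a homeomorphism (`exists_conjugacy`). -/

theorem eventually_notMem_of_finite {X : Type*} [TopologicalSpace X] [T1Space X] {C : Set X}
    (hC : C.Finite) (x : X) : ∀ᶠ z in 𝓝[≠] x, z ∉ C := by
  have := (hC.subset (sdiff_subset (t := {x}))).isClosed.isOpen_compl.mem_nhds
    (show x ∈ (C \ {x})ᶜ by simp)
  filter_upwards [mem_nhdsWithin_of_mem_nhds this, self_mem_nhdsWithin] with z hz hzc hzC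
  exact hz ⟨hzC, hzc⟩

/-! ### Affine branches of a monotone function with one slope and finitely many jumps -/

/-- Subtracting the slope leaves only the jumps at points of `C`, and these go upwards because `f`
is monotone. The induction is on the number of points of `C` between `x` and `y`. -/
theorem monotoneOn_sub_mul {f : ℝ → ℝ} {m p r : ℝ} {C : Set ℝ} (hC : C.Finite)
    (hf : MonotoneOn f (Ioo p r \ C))
    (hconst : ∀ x ∈ Ioo p r \ C, ∀ y ∈ Ioo p r \ C, x < y → Ioo x y ∩ C = ∅ →
      f x - m * x = f y - m * y) :
    MonotoneOn (fun x => f x - m * x) (Ioo p r \ C) := by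
  have key : ∀ N : ℕ, ∀ x ∈ Ioo p r \ C, ∀ y ∈ Ioo p r \ C, x < y → (Ioo x y ∩ C).ncard < N →
      f x - m * x ≤ f y - m * y := by
    intro N
    induction N with
    | zero => intro x _ y _ _ h; omega
    | succ N ih =>
      intro x hx y hy hxy hcard
      rcases (Ioo x y ∩ C).eq_empty_or_nonempty with he | ⟨c, ⟨hxc, hcy⟩, hcC⟩
      · exact (hconst x hx y hy hxy he).le
      have fin : (Ioo x y ∩ C).Finite := hC.subset inter_subset_right
      -- Stepping over `c` from `c - ε / 2` to `c + ε / 2` costs at most `m * ε`, which vanishes in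
      -- the limit.
      have hdiv : Tendsto (fun ε : ℝ => f y - m * y + m * ε) (𝓝[>] 0) (𝓝 (f y - m * y)) := by
        have : Tendsto (fun ε : ℝ => f y - m * y + m * ε) (𝓝 0) (𝓝 (f y - m * y + m * 0)) :=
          Continuous.tendsto (by fun_prop) 0
        simpa using this.mono_left nhdsWithin_le_nhds
      refine ge_of_tendsto hdiv ?_
      have hl : Tendsto (fun ε : ℝ => c - ε / 2) (𝓝[>] 0) (𝓝[≠] c) := by
        refine tendsto_nhdsWithin_iff.2 ⟨?_, ?_⟩
        · have : Tendsto (fun ε : ℝ => c - ε / 2) (𝓝 0) (𝓝 (c - 0 / 2)) :=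
            Continuous.tendsto (by fun_prop) 0
          simpa using this.mono_left nhdsWithin_le_nhds
        · filter_upwards [self_mem_nhdsWithin] with ε (hε : 0 < ε)
          simp; linarith
      have hr : Tendsto (fun ε : ℝ => c + ε / 2) (𝓝[>] 0) (𝓝[≠] c) := by
        refine tendsto_nhdsWithin_iff.2 ⟨?_, ?_⟩
        · have : Tendsto (fun ε : ℝ => c + ε / 2) (𝓝 0) (𝓝 (c + 0 / 2)) :=
            Continuous.tendsto (by fun_prop) 0
          simpa using this.mono_left nhdsWithin_le_nhds
        · filter_upwards [self_mem_nhdsWithin] with ε (hε : 0 < ε)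
          simp; linarith
      have hε1 : ∀ᶠ ε : ℝ in 𝓝[>] 0, ε < min (c - x) (y - c) :=
        mem_nhdsWithin_of_mem_nhds (Iio_mem_nhds (lt_min (by linarith) (by linarith)))
      filter_upwards [hl.eventually (eventually_notMem_of_finite hC c),
        hr.eventually (eventually_notMem_of_finite hC c), hε1, self_mem_nhdsWithin]
        with ε h1 h2 h3 (h4 : 0 < ε)
      rw [lt_min_iff] at h3
      have hz : c - ε / 2 ∈ Ioo p r \ C :=
        ⟨⟨by linarith [hx.1.1], by linarith [hy.1.2]⟩, h1⟩
      have hw : c + ε / 2 ∈ Ioo p r \ C :=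
        ⟨⟨by linarith [hx.1.1], by linarith [hy.1.2]⟩, h2⟩
      have hlt : ∀ s t, x ≤ s → t ≤ y → c ∉ Ioo s t → (Ioo s t ∩ C).ncard < N := by
        intro s t hs ht hc
        have : (Ioo s t ∩ C).ncard < (Ioo x y ∩ C).ncard := by
          refine ncard_lt_ncard ⟨?_, fun h => hc (h ⟨⟨hxc, hcy⟩, hcC⟩).1⟩ fin
          rintro z ⟨⟨h1, h2⟩, h3⟩
          exact ⟨⟨by linarith, by linarith⟩, h3⟩
        omega
      have i1 := ih x hx _ hz (by linarith)
        (hlt _ _ le_rfl (by linarith) (fun h => by linarith [h.2]))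
      have i2 := ih _ hw y hy (by linarith)
        (hlt _ _ (by linarith) le_rfl (fun h => by linarith [h.1]))
      have i3 := hf hz hw (by linarith)
      nlinarith
  intro x hx y hy hxy
  rcases hxy.eq_or_lt with rfl | h
  · exact le_rfl
  · exact key _ x hx y hy h (Nat.lt_succ_self _)

/-- If the offset `f x - m * x` increased from `x` to `y`, let `t` be the next of its finitely many
values and `c` the place where it leaves the old one. Then `f` omits the nonempty interval between
`m * c + g x` and `m * c + t`, which meets `Ioo u v` and contradicts density. -/
theorem sub_mul_eq_of_image_dense {f : ℝ → ℝ} {m u v : ℝ} {D : Set ℝ} (hm : 0 < m)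
    (hg : MonotoneOn (fun x => f x - m * x) D) (hfin : ((fun x => f x - m * x) '' D).Finite)
    (hdense : Ioo u v ⊆ closure (f '' D)) {x y : ℝ} (hx : x ∈ D) (hy : y ∈ D)
    (hfx : f x ∈ Ioo u v) (hfy : f y ∈ Ioo u v) : f x - m * x = f y - m * y := by
  wlog hxy : x ≤ y generalizing x y
  · exact (this hy hx hfy hfx (le_of_not_ge hxy)).symm
  by_contra hne
  set g := fun x => f x - m * x with hgdef
  have hlt : g x < g y := lt_of_le_of_ne (hg hx hy hxy) hne
  obtain ⟨t, ⟨ht1, ht2⟩, htmin⟩ := (hfin.subset (sep_subset _ (fun t => g x < t))).isCompact.exists_isLeast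
    ⟨g y, ⟨y, hy, rfl⟩, hlt⟩
  have hbelow : ∀ z ∈ D, g z ≤ g x → z ≤ y := fun z hz hzx => by
    by_contra! h
    exact absurd (hg hy hz h.le) (not_le.2 (hzx.trans_lt hlt))
  set S := {z | z ∈ D ∧ g z ≤ g x}
  have hSb : BddAbove S := ⟨y, fun z hz => hbelow z hz.1 hz.2⟩
  have hSx : x ∈ S := ⟨hx, le_rfl⟩
  set c := sSup S
  have hxc : x ≤ c := le_csSup hSb hSx
  have hcy : c ≤ y := csSup_le ⟨x, hSx⟩ fun z hz => hbelow z hz.1 hz.2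
  have hgap : ∀ z ∈ D, f z ≤ m * c + g x ∨ m * c + t ≤ f z := by
    intro z hz
    by_cases h : g z ≤ g x
    · left
      have : z ≤ c := le_csSup hSb ⟨hz, h⟩
      have h' : f z - m * z ≤ g x := h
      nlinarith
    · right
      have hcz : c ≤ z := csSup_le ⟨x, hSx⟩ fun w hw => by
        by_contra! hzw
        exact h ((hg hz hw.1 hzw.le).trans hw.2)
      have h' : t ≤ f z - m * z := htmin ⟨⟨z, hz, rfl⟩, not_le.1 h⟩
      nlinarith
  have h1 : u < m * c + g x := by
    have : g x = f x - m * x := rfl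
    nlinarith [hfx.1]
  have h2 : m * c + g x < v := by
    have : g y = f y - m * y := rfl
    nlinarith [hfy.2]
  have ht : g x < t := ht2
  obtain ⟨w, hw1, hw2⟩ := exists_between (lt_min h2 (show m * c + g x < m * c + t by linarith))
  obtain ⟨_, ⟨⟨hz1, hz2⟩, z, hz, rfl⟩⟩ := mem_closure_iff.1
    (hdense ⟨h1.trans hw1, hw2.trans_le (min_le_left _ _)⟩)
    (Ioo (m * c + g x) (m * c + t)) isOpen_Ioo ⟨hw1, hw2.trans_le (min_le_right _ _)⟩
  rcases hgap z hz with h | h <;> linarith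

theorem exists_affine_branch_of_monotoneOn {f : ℝ → ℝ} {m p r u v : ℝ} {C : Set ℝ}
    (hC : C.Finite) (hm : 0 < m) (hf : MonotoneOn f (Ioo p r \ C))
    (hconst : ∀ x ∈ Ioo p r \ C, ∀ y ∈ Ioo p r \ C, x < y → Ioo x y ∩ C = ∅ →
      f x - m * x = f y - m * y)
    (hfin : ((fun x => f x - m * x) '' (Ioo p r \ C)).Finite) (huv : u < v)
    (hdense : Ioo u v ⊆ closure (f '' (Ioo p r \ C))) :
    ∃ d, (∀ x ∈ Ioo p r \ C, f x ∈ Ioo u v → f x = m * x + d) ∧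
      (∀ x, m * x + d ∈ Icc u v → x ∈ Icc p r) ∧
      ∀ x ∈ Ioo p r \ C, m * x + d ∈ Ioo u v → f x = m * x + d := by
  have hg := monotoneOn_sub_mul hC hf hconst
  have hdense' : ∀ s t, u ≤ s → s < t → t ≤ v → ∃ x ∈ Ioo p r \ C, f x ∈ Ioo s t := by
    intro s t hs hst ht
    obtain ⟨w, hw1, hw2⟩ := exists_between hst
    obtain ⟨_, h, x, hx, rfl⟩ := mem_closure_iff.1
      (hdense ⟨hs.trans_lt hw1, hw2.trans_le ht⟩) (Ioo s t) isOpen_Ioo ⟨hw1, hw2⟩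
    exact ⟨x, hx, h⟩
  obtain ⟨x₀, hx₀, hfx₀⟩ := hdense' u v le_rfl huv le_rfl
  have hd : ∀ x ∈ Ioo p r \ C, f x ∈ Ioo u v → f x = m * x + (f x₀ - m * x₀) := fun x hx h => by
    have := sub_mul_eq_of_image_dense hm hg hfin hdense hx hx₀ h hfx₀
    linarith
  set d := f x₀ - m * x₀
  refine ⟨d, hd, ?_, ?_⟩
  · intro x hx
    constructor
    -- If `x < p`, every point of the branch lies at distance more than `p - x` from `x`, so values
    -- just above `u` are never taken; the other end is symmetric.
    · by_contra! hxp
      obtain ⟨z, hz, hfz⟩ := hdense' u (min v (u + m * (p - x))) le_rfl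
        (lt_min huv (by nlinarith)) (min_le_left _ _)
      have h1 := hfz.2.trans_le (min_le_right _ _)
      have h2 := hd z hz ⟨hfz.1, hfz.2.trans_le (min_le_left _ _)⟩
      nlinarith [hz.1.1, hx.1]
    · by_contra! hxp
      obtain ⟨z, hz, hfz⟩ := hdense' (max u (v - m * (x - r))) v (le_max_left _ _)
        (max_lt huv (by nlinarith)) le_rfl
      have h1 := (le_max_right _ _).trans_lt hfz.1
      have h2 := hd z hz ⟨(le_max_left _ _).trans_lt hfz.1, hfz.2⟩
      nlinarith [hz.1.2, hx.2]
  · intro x hx h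
    -- Points with values just below and just above `m * x + d` lie on the branch on either side of
    -- `x`, and the monotone offset is squeezed between two equal values.
    obtain ⟨y, hy, hfy⟩ := hdense' u _ le_rfl h.1 h.2.le
    obtain ⟨z, hz, hfz⟩ := hdense' _ v h.1.le h.2 le_rfl
    have h1 := hd y hy ⟨hfy.1, hfy.2.trans h.2⟩
    have h2 := hd z hz ⟨h.1.trans hfz.1, hfz.2⟩
    have i1 : f y - m * y ≤ f x - m * x := hg hy hx (by nlinarith [hfy.2])
    have i2 : f x - m * x ≤ f z - m * z := hg hx hz (by nlinarith [hfz.1])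
    linarith

theorem slope_nonneg_of_monotoneOn {f : ℝ → ℝ} {m p r : ℝ} {C : Set ℝ}
    (hC : C.Finite) (hpr : p < r) (hf : MonotoneOn f (Ioo p r \ C))
    (hconst : ∀ x ∈ Ioo p r \ C, ∀ y ∈ Ioo p r \ C, x < y → Ioo x y ∩ C = ∅ →
      f x - m * x = f y - m * y) : 0 ≤ m := by
  have hinf := ((Ioo_infinite hpr).sdiff hC).nonempty
  obtain ⟨x, hx⟩ := hinf
  obtain ⟨y, hxy, hy⟩ := (mem_nhdsGE_iff_exists_Ico_subset).1 (mem_nhdsWithin_of_mem_nhds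
    ((isOpen_Ioo.sdiff hC.isClosed).mem_nhds hx))
  have hxy : x < y := hxy
  have hz : (x + y) / 2 ∈ Ioo p r \ C := hy ⟨by linarith, by linarith⟩
  have h1 := hconst x hx _ hz (by linarith) (by
    rw [eq_empty_iff_forall_notMem]
    exact fun w hw => (hy ⟨hw.1.1.le, by linarith [hw.1.2]⟩).2 hw.2)
  have h2 := hf hx hz (by linarith)
  nlinarith

theorem exists_affine_branch {f : ℝ → ℝ} {m p r u v : ℝ} {C : Set ℝ}
    (hC : C.Finite) (hm : m ≠ 0) (hpr : p < r)
    (hf : MonotoneOn f (Ioo p r \ C) ∨ AntitoneOn f (Ioo p r \ C))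
    (hconst : ∀ x ∈ Ioo p r \ C, ∀ y ∈ Ioo p r \ C, x < y → Ioo x y ∩ C = ∅ →
      f x - m * x = f y - m * y)
    (hfin : ((fun x => f x - m * x) '' (Ioo p r \ C)).Finite) (huv : u < v)
    (hdense : Ioo u v ⊆ closure (f '' (Ioo p r \ C))) :
    ∃ d, (∀ x ∈ Ioo p r \ C, f x ∈ Ioo u v → f x = m * x + d) ∧
      (∀ x, m * x + d ∈ Icc u v → x ∈ Icc p r) ∧
      ∀ x ∈ Ioo p r \ C, m * x + d ∈ Ioo u v → f x = m * x + d := by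
  rcases hf with hf | hf
  · exact exists_affine_branch_of_monotoneOn hC
      ((slope_nonneg_of_monotoneOn hC hpr hf hconst).lt_of_ne' hm) hf hconst hfin huv hdense
  · have hconst' : ∀ x ∈ Ioo p r \ C, ∀ y ∈ Ioo p r \ C, x < y → Ioo x y ∩ C = ∅ →
        (-f) x - (-m) * x = (-f) y - (-m) * y := fun x hx y hy hxy h => by
      have := hconst x hx y hy hxy h
      simp only [Pi.neg_apply]; linarith
    have hfin' : ((fun x => (-f) x - (-m) * x) '' (Ioo p r \ C)).Finite := by
      have := hfin.image (fun x : ℝ => -x)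
      rw [image_image] at this
      convert this using 2
      simp only [Pi.neg_apply]; ring
    have hdense' : Ioo (-v) (-u) ⊆ closure ((-f) '' (Ioo p r \ C)) := by
      intro y hy
      have h1 : -y ∈ closure (f '' (Ioo p r \ C)) := hdense ⟨by linarith [hy.2], by linarith [hy.1]⟩
      have h2 := map_mem_closure continuous_neg h1 (t := (-f) '' (Ioo p r \ C)) (by
        rintro _ ⟨x, hx, rfl⟩
        exact ⟨x, hx, rfl⟩)
      simpa using h2
    obtain ⟨d, h1, h2, h3⟩ := exists_affine_branch_of_monotoneOn hC
      ((slope_nonneg_of_monotoneOn hC hpr hf.neg hconst').lt_of_ne' (neg_ne_zero.2 hm)) hf.neg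
      hconst' hfin' (neg_lt_neg huv) hdense'
    refine ⟨-d, fun x hx h => ?_, fun x h => h2 x ?_, fun x hx h => ?_⟩
    · have : -f x = -m * x + d := h1 x hx ⟨neg_lt_neg h.2, neg_lt_neg h.1⟩
      linarith
    · exact ⟨by linarith [h.2], by linarith [h.1]⟩
    · have : -f x = -m * x + d := h3 x hx ⟨by linarith [h.2], by linarith [h.1]⟩
      linarith

/-! ### Partition intervals, one-sided limits and the slopes of the map -/

theorem exists_mem_Ioc_of_partition {α : Type*} [LinearOrder α] {q : ℕ} {b : Fin (q + 1) → α}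
    {x : α} (h0 : b 0 < x) (h1 : x ≤ b (Fin.last q)) :
    ∃ i : Fin q, x ∈ Ioc (b i.castSucc) (b i.succ) := by
  by_contra! h
  have : ∀ i, b i < x := fun i => by
    induction i using Fin.induction with
    | zero => exact h0
    | succ i ih => exact not_le.1 fun hx => h i ⟨ih, hx⟩
  exact absurd h1 (not_le.2 (this _))

theorem exists_mem_Ico_of_partition {α : Type*} [LinearOrder α] {q : ℕ} {b : Fin (q + 1) → α}
    {x : α} (h0 : b 0 ≤ x) (h1 : x < b (Fin.last q)) :
    ∃ i : Fin q, x ∈ Ico (b i.castSucc) (b i.succ) := by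
  by_contra! h
  have : ∀ i, b i ≤ x := fun i => by
    induction i using Fin.induction with
    | zero => exact h0
    | succ i ih => exact not_lt.1 fun hx => h i ⟨ih, hx⟩
  exact absurd h1 (not_lt.2 (this _))

theorem exists_mem_Ioo_of_partition {q : ℕ} {b : Fin (q + 1) → unitInterval} (h0 : b 0 = 0)
    (h1 : b (Fin.last q) = 1) {x : unitInterval} (hx : x ∉ range b) :
    ∃ i : Fin q, x ∈ Ioo (b i.castSucc) (b i.succ) := by
  have hx0 : b 0 < x := lt_of_le_of_ne (h0 ▸ unitInterval.nonneg') fun h => hx ⟨_, h⟩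
  obtain ⟨i, hi, hi'⟩ := exists_mem_Ioc_of_partition hx0 (h1 ▸ unitInterval.le_one')
  exact ⟨i, hi, lt_of_le_of_ne hi' fun h => hx ⟨_, h.symm⟩⟩

theorem eq_of_mem_Ioo_of_mem_Icc {α : Type*} [LinearOrder α] {q : ℕ} {b : Fin (q + 1) → α}
    (hb : StrictMono b) {x : α} {i j : Fin q} (hi : x ∈ Ioo (b i.castSucc) (b i.succ))
    (hj : x ∈ Icc (b j.castSucc) (b j.succ)) : i = j := by
  have h1 := hb.lt_iff_lt.1 (hi.1.trans_le hj.2)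
  have h2 := hb.lt_iff_lt.1 (hj.1.trans_lt hi.2)
  simp only [Fin.lt_def, Fin.val_castSucc, Fin.val_succ] at h1 h2
  exact Fin.ext (by omega)

theorem notMem_range_of_mem_Ioo {α : Type*} [LinearOrder α] {q : ℕ} {b : Fin (q + 1) → α}
    (hb : StrictMono b) {x : α} {i : Fin q} (hi : x ∈ Ioo (b i.castSucc) (b i.succ)) :
    x ∉ range b := by
  rintro ⟨k, rfl⟩
  have h1 := hb.lt_iff_lt.1 hi.1
  have h2 := hb.lt_iff_lt.1 hi.2
  simp only [Fin.lt_def, Fin.val_castSucc, Fin.val_succ] at h1 h2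
  omega

theorem hat_eq_singleton {τ : unitInterval → unitInterval} {n : ℕ}
    {a : Fin (n + 1) → unitInterval} (hτ : IsPiecewiseMonotonic τ a) {x : unitInterval}
    (hx : x ∉ range a) : hat τ x = {τ x} := by
  obtain ⟨i, hi⟩ := exists_mem_Ioo_of_partition hτ.first hτ.last hx
  have hc : Tendsto τ (𝓝 x) (𝓝 (τ x)) :=
    (hτ.continuousOn i).continuousAt (isOpen_Ioo.mem_nhds hi)
  have h0 : 0 < x := lt_of_le_of_lt unitInterval.nonneg' hi.1
  have h1 : x < 1 := lt_of_lt_of_le hi.2 unitInterval.le_one'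
  have n0 : (𝓝[<] x).NeBot := nhdsLT_neBot_of_exists_lt ⟨0, h0⟩
  have n1 : (𝓝[>] x).NeBot := nhdsGT_neBot_of_exists_gt ⟨1, h1⟩
  ext y
  simp only [hat, mem_ofPred_eq, mem_singleton_iff]
  constructor
  · rintro (⟨-, h⟩ | ⟨-, h⟩)
    · exact tendsto_nhds_unique h (hc.mono_left nhdsWithin_le_nhds)
    · exact tendsto_nhds_unique h (hc.mono_left nhdsWithin_le_nhds)
  · rintro rfl
    exact Or.inl ⟨h0, hc.mono_left nhdsWithin_le_nhds⟩

theorem exists_filter_of_mem_hat {τ : unitInterval → unitInterval} {q : ℕ}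
    {b : Fin (q + 1) → unitInterval} {C : Set unitInterval} (hC : C.Finite) (h0 : b 0 = 0)
    (h1 : b (Fin.last q) = 1) {x y : unitInterval} (hy : y ∈ hat τ x) :
    ∃ i : Fin q, x ∈ Icc (b i.castSucc) (b i.succ) ∧ ∃ F : Filter unitInterval, F.NeBot ∧
      F ≤ 𝓝 x ∧ (∀ᶠ z in F, z ∈ Ioo (b i.castSucc) (b i.succ) \ C) ∧ Tendsto τ F (𝓝 y) := by
  rcases hy with ⟨hx, hy⟩ | ⟨hx, hy⟩
  · obtain ⟨i, hi⟩ := exists_mem_Ioc_of_partition (b := b) (h0 ▸ hx) (h1 ▸ unitInterval.le_one')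
    refine ⟨i, ⟨hi.1.le, hi.2⟩, 𝓝[<] x, nhdsLT_neBot_of_exists_lt ⟨0, hx⟩, nhdsWithin_le_nhds,
      ?_, hy⟩
    have h1 : ∀ᶠ z in 𝓝[<] x, z ∈ Ioo (b i.castSucc) x := Ioo_mem_nhdsLT hi.1
    have h2 := (eventually_notMem_of_finite hC x).filter_mono
      (nhdsWithin_mono x fun z (hz : z < x) => hz.ne)
    filter_upwards [h1, h2] with z hz hzC
    exact ⟨⟨hz.1, hz.2.trans_le hi.2⟩, hzC⟩
  · obtain ⟨i, hi⟩ := exists_mem_Ico_of_partition (b := b) (h0 ▸ unitInterval.nonneg') (h1 ▸ hx)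
    refine ⟨i, ⟨hi.1, hi.2.le⟩, 𝓝[>] x, nhdsGT_neBot_of_exists_gt ⟨1, hx⟩, nhdsWithin_le_nhds,
      ?_, hy⟩
    have h1 : ∀ᶠ z in 𝓝[>] x, z ∈ Ioo x (b i.succ) := Ioo_mem_nhdsGT hi.2
    have h2 := (eventually_notMem_of_finite hC x).filter_mono
      (nhdsWithin_mono x fun z (hz : x < z) => hz.ne')
    filter_upwards [h1, h2] with z hz hzC
    exact ⟨⟨hi.1.trans_lt hz.1, hz.2⟩, hzC⟩

theorem exists_slope {τ : unitInterval → unitInterval} {n q : ℕ}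
    {a : Fin (n + 1) → unitInterval} {b : Fin (q + 1) → unitInterval}
    (hτ : IsPiecewiseMonotonic τ a) (hb : IsMarkovPartition τ (range a) b)
    (hlin : IsPiecewiseLinear τ a b) (i : Fin q) :
    ∃ m : ℝ, m ≠ 0 ∧ ∀ j : Fin q, ∃ d : ℝ,
      Ioo (b j.castSucc) (b j.succ) ⊆
        closure (partialImage τ (range a) (Ioo (b i.castSucc) (b i.succ))) →
      (∀ x ∈ Ioo (b i.castSucc) (b i.succ) \ range a, τ x ∈ Ioo (b j.castSucc) (b j.succ) →
        (τ x : ℝ) = m * x + d) ∧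
      (∀ x : ℝ, m * x + d ∈ Icc (b j.castSucc : ℝ) (b j.succ) →
        x ∈ Icc (b i.castSucc : ℝ) (b i.succ)) ∧
      ∀ x ∈ Ioo (b i.castSucc) (b i.succ) \ range a,
        m * x + d ∈ Ioo (b j.castSucc : ℝ) (b j.succ) → (τ x : ℝ) = m * x + d := by
  obtain ⟨m, hm⟩ := hlin i
  choose e he using hm
  set p : ℝ := (b i.castSucc : ℝ)
  set r : ℝ := (b i.succ : ℝ)
  have hpr : p < r := hb.strictMono (Fin.castSucc_lt_succ (i := i))
  set C : Set ℝ := Subtype.val '' range a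
  have hC : C.Finite := (finite_range a).image _
  set f : ℝ → ℝ := fun x => τ (projIcc 0 1 zero_le_one x)
  have hfv : ∀ x : unitInterval, f x = τ x := fun x => by simp only [f, projIcc_val]
  have hlift : ∀ x ∈ Ioo p r \ C, ∃ z : unitInterval, (z : ℝ) = x ∧
      z ∈ Ioo (b i.castSucc) (b i.succ) \ range a := by
    rintro x ⟨hx, hxC⟩
    have h01 : x ∈ Icc (0 : ℝ) 1 :=
      ⟨(b i.castSucc).2.1.trans hx.1.le, hx.2.le.trans (b i.succ).2.2⟩
    exact ⟨⟨x, h01⟩, rfl, hx, fun h => hxC ⟨_, h, rfl⟩⟩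
  have hpush : ∀ z ∈ Ioo (b i.castSucc) (b i.succ) \ range a, (z : ℝ) ∈ Ioo p r \ C := by
    rintro z ⟨hz, hzC⟩
    refine ⟨hz, ?_⟩
    rintro ⟨w, hw, hwz⟩
    exact hzC (Subtype.ext hwz ▸ hw)
  have hpiece : ∀ x ∈ Ioo p r \ C, ∃ z : unitInterval, (z : ℝ) = x ∧ ∃ k : Fin n,
      z ∈ Ioo (b i.castSucc) (b i.succ) ∩ Ioo (a k.castSucc) (a k.succ) := by
    intro x hx
    obtain ⟨z, hzx, hz⟩ := hlift x hx
    obtain ⟨k, hk⟩ := exists_mem_Ioo_of_partition hτ.first hτ.last hz.2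
    exact ⟨z, hzx, k, hz.1, hk⟩
  have hf : MonotoneOn f (Ioo p r \ C) ∨ AntitoneOn f (Ioo p r \ C) := by
    refine (hb.monotonic i).imp (fun h x hx y hy hxy => ?_) (fun h x hx y hy hxy => ?_)
    all_goals
      obtain ⟨x, rfl, hx'⟩ := hlift x hx
      obtain ⟨y, rfl, hy'⟩ := hlift y hy
      rw [hfv, hfv]
      exact h hx' hy' hxy
  have hconst : ∀ x ∈ Ioo p r \ C, ∀ y ∈ Ioo p r \ C, x < y → Ioo x y ∩ C = ∅ →
      f x - m * x = f y - m * y := by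
    intro x hx y hy hxy hemp
    obtain ⟨x, rfl, k, hk⟩ := hpiece x hx
    obtain ⟨y, rfl, hy', hyC⟩ := hlift y hy
    have hyk : y ∈ Ioo (a k.castSucc) (a k.succ) := by
      refine ⟨hk.2.1.trans hxy, ?_⟩
      by_contra! h
      have h' : a k.succ < y := lt_of_le_of_ne h fun h => hyC ⟨_, h⟩
      exact (eq_empty_iff_forall_notMem.1 hemp (a k.succ)) ⟨⟨hk.2.2, h'⟩, _, ⟨_, rfl⟩, rfl⟩
    rw [hfv, hfv, he k x hk, he k y ⟨hy', hyk⟩]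
    ring
  have hfin : ((fun x => f x - m * x) '' (Ioo p r \ C)).Finite := by
    refine (finite_range e).subset ?_
    rintro _ ⟨x, hx, rfl⟩
    obtain ⟨x, rfl, k, hk⟩ := hpiece x hx
    refine ⟨k, ?_⟩
    simp only [hfv, he k x hk]
    ring
  -- A zero slope would make `τ` constant on a small interval, against strict monotonicity on the
  -- pieces.
  have hm0 : m ≠ 0 := by
    rintro rfl
    obtain ⟨x, hx⟩ := ((Ioo_infinite hpr).sdiff hC).nonempty
    obtain ⟨x, rfl, k, hk⟩ := hpiece x hx
    obtain ⟨y, hxy, hy⟩ := exists_Ico_subset_of_mem_nhds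
      ((isOpen_Ioo.inter isOpen_Ioo).mem_nhds hk)
      ⟨b i.succ, hk.1.2⟩
    obtain ⟨z, hxz, hzy⟩ := exists_between hxy
    have hz := hy ⟨hxz.le, hzy⟩
    have h : τ x = τ z := Subtype.ext (by rw [he k x hk, he k z hz]; ring)
    rcases hτ.monotonic k with hs | hs
    · exact (hs hk.2 hz.2 hxz).ne h
    · exact (hs hk.2 hz.2 hxz).ne' h
  refine ⟨m, hm0, fun j => ?_⟩
  by_cases hd : Ioo (b j.castSucc) (b j.succ) ⊆
        closure (partialImage τ (range a) (Ioo (b i.castSucc) (b i.succ)))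
  swap
  -- When `j` is not covered the offset is a dummy value.
  · exact ⟨0, fun h => absurd h hd⟩
  have huv : (b j.castSucc : ℝ) < b j.succ := hb.strictMono (Fin.castSucc_lt_succ (i := j))
  have hdense : Ioo (b j.castSucc : ℝ) (b j.succ) ⊆ closure (f '' (Ioo p r \ C)) := by
    intro y hy
    have h01 : y ∈ Icc (0 : ℝ) 1 :=
      ⟨(b j.castSucc).2.1.trans hy.1.le, hy.2.le.trans (b j.succ).2.2⟩
    refine map_mem_closure continuous_subtype_val (hd (show (⟨y, h01⟩ : unitInterval) ∈ _ from hy))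
      ?_
    rintro _ ⟨z, hz, rfl⟩
    exact ⟨z, hpush z hz, hfv z⟩
  obtain ⟨d, h1, h2, h3⟩ := exists_affine_branch hC hm0 hpr hf hconst hfin huv hdense
  refine ⟨d, fun _ => ⟨fun x hx h => ?_, h2, fun x hx h => ?_⟩⟩
  · rw [← hfv]
    exact h1 x (hpush x hx) (by rw [hfv]; exact h)
  · rw [← hfv]
    exact h3 x (hpush x hx) h

/-! ### The branch system of a Markov map and its generalized orbit -/

/-- The affine inverse branches of a piecewise linear Markov map: `R i j` says that the `i`-th
Markov interval maps over the `j`-th one, and the branch doing so is `x ↦ m i * x + d i j`. -/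
structure IsBranchSystem (τ : unitInterval → unitInterval) (C : Set unitInterval) {q : ℕ}
    (b : Fin (q + 1) → unitInterval) (R : Fin q → Fin q → Prop) (m : Fin q → ℝ)
    (d : Fin q → Fin q → ℝ) : Prop where
  strictMono : StrictMono b
  first : b 0 = 0
  last : b (Fin.last q) = 1
  finite : C.Finite
  hat_eq : ∀ x ∉ C, hat τ x = {τ x}
  slope_ne : ∀ i, m i ≠ 0
  mapsTo : ∀ i j, R i j → ∀ x : ℝ, m i * x + d i j ∈ Icc (b j.castSucc : ℝ) (b j.succ) →
    x ∈ Icc (b i.castSucc : ℝ) (b i.succ)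
  of_mem : ∀ i j, ∀ x ∈ Ioo (b i.castSucc) (b i.succ) \ C, τ x ∈ Ioo (b j.castSucc) (b j.succ) →
    R i j ∧ (τ x : ℝ) = m i * x + d i j
  apply : ∀ i j, R i j → ∀ x ∈ Ioo (b i.castSucc) (b i.succ) \ C,
    m i * x + d i j ∈ Ioo (b j.castSucc : ℝ) (b j.succ) → (τ x : ℝ) = m i * x + d i j
  countable_orbit : (generalizedOrbit τ C).Countable
  mem_orbit : ∀ i, b i ∈ generalizedOrbit τ C
  eventually_mem : ∀ x ∈ generalizedOrbit τ C, ∃ k, (hatImage τ)^[k] {x} ⊆ range b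

theorem hatImage_mono (τ : unitInterval → unitInterval) : Monotone (hatImage τ) :=
  fun _ _ h => biUnion_subset_biUnion_left h

theorem mem_hatImage {τ : unitInterval → unitInterval} {U : Set unitInterval} {y : unitInterval} :
    y ∈ hatImage τ U ↔ ∃ x ∈ U, y ∈ hat τ x := by
  simp [hatImage]

theorem preimage_affine {m e u v : ℝ} (hm : m ≠ 0) (huv : u < v) :
    ∃ p r, p < r ∧ (∀ x, m * x + e ∈ Ioo u v ↔ x ∈ Ioo p r) ∧
      (∀ x, m * x + e ∈ Icc u v ↔ x ∈ Icc p r) ∧ |m| * (r - p) = v - u := by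
  rcases hm.lt_or_gt with h | h
  · refine ⟨(v - e) / m, (u - e) / m, ?_, fun x => ?_, fun x => ?_, ?_⟩
    · rw [div_lt_div_right_of_neg h]; linarith
    · rw [mem_Ioo, mem_Ioo, div_lt_iff_of_neg h, lt_div_iff_of_neg h]
      constructor <;> rintro ⟨h1, h2⟩ <;> constructor <;> linarith
    · rw [mem_Icc, mem_Icc, div_le_iff_of_neg h, le_div_iff_of_neg h]
      constructor <;> rintro ⟨h1, h2⟩ <;> constructor <;> linarith
    · rw [abs_of_neg h]; field_simp; ring
  · refine ⟨(u - e) / m, (v - e) / m, ?_, fun x => ?_, fun x => ?_, ?_⟩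
    · rw [div_lt_div_iff_of_pos_right h]; linarith
    · rw [mem_Ioo, mem_Ioo, div_lt_iff₀ h, lt_div_iff₀ h]
      constructor <;> rintro ⟨h1, h2⟩ <;> constructor <;> linarith
    · rw [mem_Icc, mem_Icc, div_le_iff₀ h, le_div_iff₀ h]
      constructor <;> rintro ⟨h1, h2⟩ <;> constructor <;> linarith
    · rw [abs_of_pos h]; field_simp; ring

/-- Pulling back adds one iterate: off `C` the map is single-valued, so all of `hat τ x` is the
given image, while on `C` the Markov hypothesis applies directly. -/
theorem generalizedOrbit_subset {τ : unitInterval → unitInterval} {C B : Set unitInterval}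
    (hhat : ∀ x ∉ C, hat τ x = {τ x}) (hB : ∀ x ∈ B, hat τ x ⊆ B)
    (hC : ∃ k, (hatImage τ)^[k] C ⊆ B) {x : unitInterval} (hx : x ∈ generalizedOrbit τ C) :
    ∃ k, (hatImage τ)^[k] {x} ⊆ B := by
  obtain ⟨k₀, hk₀⟩ := hC
  have hCx : ∀ x ∈ C, ∃ k, (hatImage τ)^[k] {x} ⊆ B := fun x hx =>
    ⟨k₀, ((hatImage_mono τ).iterate k₀ (singleton_subset_iff.2 hx)).trans hk₀⟩
  induction hx with
  | base hx => exact hCx _ hx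
  | @image x y _ hy ih =>
    obtain ⟨k, hk⟩ := ih
    cases k with
    | zero => exact ⟨0, singleton_subset_iff.2 (hB x (singleton_subset_iff.1 hk) hy)⟩
    | succ k =>
      refine ⟨k, Subset.trans ?_ hk⟩
      rw [Function.iterate_succ_apply]
      exact (hatImage_mono τ).iterate k (singleton_subset_iff.2 (mem_hatImage.2 ⟨x, rfl, hy⟩))
  | @preimage x y _ hxy ih =>
    by_cases hxC : x ∈ C
    · exact hCx x hxC
    · obtain ⟨k, hk⟩ := ih
      refine ⟨k + 1, ?_⟩
      rw [hhat x hxC, mem_singleton_iff] at hxy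
      rw [Function.iterate_succ_apply]
      have : hatImage τ {x} = {y} := by simp [hatImage, hhat x hxC, hxy]
      rwa [this]

/-- `τ` is injective on each piece, so preimages of countable sets are countable. Countability makes
the complement of the orbit dense, and there `τ̂` and `τ` agree. -/
theorem countable_generalizedOrbit {τ : unitInterval → unitInterval} {n : ℕ}
    {a : Fin (n + 1) → unitInterval} (hτ : IsPiecewiseMonotonic τ a) {B : Set unitInterval}
    (hBc : B.Countable) (hB : ∀ x ∈ B, hat τ x ⊆ B)
    (hC : ∃ k, (hatImage τ)^[k] (range a) ⊆ B) : (generalizedOrbit τ (range a)).Countable := by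
  have hk : ∀ k, {x | (hatImage τ)^[k] {x} ⊆ B}.Countable := by
    intro k
    induction k with
    | zero => simpa using hBc
    | succ k ih =>
      have hcount : (range a ∪ ⋃ i : Fin n, {x | x ∈ Ioo (a i.castSucc) (a i.succ) ∧
          τ x ∈ {x | (hatImage τ)^[k] {x} ⊆ B}}).Countable := by
        refine (finite_range a).countable.union (countable_iUnion fun i => ?_)
        refine MapsTo.countable_of_injOn (f := τ) (fun x hx => hx.2) ?_ ih
        have hinj : InjOn τ (Ioo (a i.castSucc) (a i.succ)) :=
          (hτ.monotonic i).elim StrictMonoOn.injOn StrictAntiOn.injOn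
        exact hinj.mono fun x hx => hx.1
      refine hcount.mono fun x hx => ?_
      by_cases hxC : x ∈ range a
      · exact Or.inl hxC
      · obtain ⟨i, hi⟩ := exists_mem_Ioo_of_partition hτ.first hτ.last hxC
        refine Or.inr (mem_iUnion.2 ⟨i, hi, ?_⟩)
        have h1 : (hatImage τ)^[k + 1] {x} ⊆ B := hx
        rw [Function.iterate_succ_apply] at h1
        have : hatImage τ {x} = {τ x} := by simp [hatImage, hat_eq_singleton hτ hxC]
        rwa [this] at h1
  refine (countable_iUnion hk).mono fun x hx => mem_iUnion.2 ?_
  exact generalizedOrbit_subset (fun x hx => hat_eq_singleton hτ hx) hB hC hx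

/-- The Markov interval `i` maps over the Markov interval `j`. -/
def Covers (τ : unitInterval → unitInterval) (C : Set unitInterval) {q : ℕ}
    (b : Fin (q + 1) → unitInterval) (i j : Fin q) : Prop :=
  Ioo (b j.castSucc) (b j.succ) ⊆ closure (partialImage τ C (Ioo (b i.castSucc) (b i.succ)))

theorem covers_of_mem {τ : unitInterval → unitInterval} {C : Set unitInterval} {q : ℕ}
    {b : Fin (q + 1) → unitInterval} (hb : IsMarkovPartition τ C b) {i j : Fin q}
    {x : unitInterval} (hx : x ∈ Ioo (b i.castSucc) (b i.succ) \ C)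
    (hy : τ x ∈ Ioo (b j.castSucc) (b j.succ)) : Covers τ C b i j := by
  obtain ⟨S, hS⟩ := hb.closure_image i
  have h : τ x ∈ closure (partialImage τ C (Ioo (b i.castSucc) (b i.succ))) :=
    subset_closure ⟨x, hx, rfl⟩
  rw [hS, mem_iUnion₂] at h
  obtain ⟨l, hl, hxl⟩ := h
  obtain rfl := eq_of_mem_Ioo_of_mem_Icc hb.strictMono hy hxl
  rw [Covers, hS]
  exact Ioo_subset_Icc_self.trans (subset_biUnion_of_mem (u := fun j : Fin q => Icc (b j.castSucc) (b j.succ)) hl)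

theorem mem_Ioo_of_forall_mem_Icc {m e u v p r : ℝ}
    (h : ∀ x, m * x + e ∈ Icc u v → x ∈ Icc p r) {x : ℝ} (hx : m * x + e ∈ Ioo u v) :
    x ∈ Ioo p r := by
  have ho : IsOpen {x | m * x + e ∈ Ioo u v} := isOpen_Ioo.preimage (by fun_prop)
  have hs : {x | m * x + e ∈ Ioo u v} ⊆ Icc p r := fun x hx => h x (Ioo_subset_Icc_self hx)
  have := interior_maximal hs ho hx
  rwa [interior_Icc] at this

/-- Along the one-sided filter the values are eventually in the open interval of `y`, hence on one
affine branch, and the formula passes to the limit. The hypotheses are kept separate because the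
lemma is needed to build the branch system itself. -/
theorem exists_branch_of_mem_hat {τ : unitInterval → unitInterval} {C : Set unitInterval} {q : ℕ}
    {b : Fin (q + 1) → unitInterval} {R : Fin q → Fin q → Prop} {m : Fin q → ℝ}
    {d : Fin q → Fin q → ℝ} (hC : C.Finite) (h0 : b 0 = 0) (h1 : b (Fin.last q) = 1)
    (hmaps : ∀ i j, R i j → ∀ x : ℝ, m i * x + d i j ∈ Icc (b j.castSucc : ℝ) (b j.succ) →
      x ∈ Icc (b i.castSucc : ℝ) (b i.succ))
    (hof : ∀ i j, ∀ x ∈ Ioo (b i.castSucc) (b i.succ) \ C,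
      τ x ∈ Ioo (b j.castSucc) (b j.succ) → R i j ∧ (τ x : ℝ) = m i * x + d i j)
    {x y : unitInterval} {j : Fin q} (hy : y ∈ hat τ x)
    (hj : y ∈ Ioo (b j.castSucc) (b j.succ)) :
    ∃ i, R i j ∧ x ∈ Ioo (b i.castSucc) (b i.succ) ∧ (y : ℝ) = m i * x + d i j := by
  obtain ⟨i, -, F, hF, hFx, hFi, hFy⟩ := exists_filter_of_mem_hat hC h0 h1 hy
  have hev : ∀ᶠ z in F, R i j ∧ (τ z : ℝ) = m i * z + d i j := by
    filter_upwards [hFi, hFy.eventually (isOpen_Ioo.mem_nhds hj)] with z h1 h2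
    exact hof i j z h1 h2
  have hc := hev.exists.choose_spec.1
  have h1 : Tendsto (fun z => (τ z : ℝ)) F (𝓝 (y : ℝ)) :=
    (continuous_subtype_val.tendsto y).comp hFy
  have h2 : Tendsto (fun z : unitInterval => m i * (z : ℝ) + d i j) F (𝓝 (m i * x + d i j)) :=
    (Continuous.tendsto (by fun_prop) x).mono_left hFx
  have h3 := tendsto_nhds_unique (h1.congr' (hev.mono fun z hz => hz.2)) h2
  have h4 : m i * (x : ℝ) + d i j ∈ Ioo (b j.castSucc : ℝ) (b j.succ) := h3 ▸ hj
  exact ⟨i, hc, mem_Ioo_of_forall_mem_Icc (hmaps i j hc) h4, h3⟩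

theorem exists_isBranchSystem {τ : unitInterval → unitInterval} {n q : ℕ}
    {a : Fin (n + 1) → unitInterval} {b : Fin (q + 1) → unitInterval}
    (hτ : IsPiecewiseMonotonic τ a) (hb : IsMarkovPartition τ (range a) b)
    (hlin : IsPiecewiseLinear τ a b) :
    ∃ m d, IsBranchSystem τ (range a) b (Covers τ (range a) b) m d := by
  choose m hm0 d hd using exists_slope hτ hb hlin
  have hof : ∀ i j, ∀ x ∈ Ioo (b i.castSucc) (b i.succ) \ range a,
      τ x ∈ Ioo (b j.castSucc) (b j.succ) →
      Covers τ (range a) b i j ∧ (τ x : ℝ) = m i * x + d i j := fun i j x hx h =>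
    have hc := covers_of_mem hb hx h
    ⟨hc, (hd i j hc).1 x hx h⟩
  have hB : ∀ x ∈ range b, hat τ x ⊆ range b := by
    intro x hx y hy
    by_contra hyB
    obtain ⟨j, hj⟩ := exists_mem_Ioo_of_partition hb.first hb.last hyB
    obtain ⟨i, -, hxi, -⟩ := exists_branch_of_mem_hat (finite_range a) hb.first hb.last
      (fun i j h => (hd i j h).2.1) hof hy hj
    exact notMem_range_of_mem_Ioo hb.strictMono hxi hx
  exact ⟨m, d, hb.strictMono, hb.first, hb.last, finite_range a,
    fun x hx => hat_eq_singleton hτ hx, hm0, fun i j h => (hd i j h).2.1, hof,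
    fun i j h => (hd i j h).2.2, countable_generalizedOrbit hτ (finite_range b).countable hB
      hb.eventually_mem, hb.mem_orbit,
    fun x hx => generalizedOrbit_subset (fun x hx => hat_eq_singleton hτ hx) hB
      hb.eventually_mem hx⟩

namespace IsBranchSystem

variable {τ : unitInterval → unitInterval} {C : Set unitInterval} {q : ℕ}
  {b : Fin (q + 1) → unitInterval} {R : Fin q → Fin q → Prop} {m : Fin q → ℝ}
  {d : Fin q → Fin q → ℝ}

theorem cell_lt (S : IsBranchSystem τ C b R m d) (i : Fin q) :
    (b i.castSucc : ℝ) < b i.succ :=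
  S.strictMono (Fin.castSucc_lt_succ (i := i))

theorem mapsTo_Ioo (S : IsBranchSystem τ C b R m d) {i j : Fin q} (h : R i j) {x : ℝ}
    (hx : m i * x + d i j ∈ Ioo (b j.castSucc : ℝ) (b j.succ)) :
    x ∈ Ioo (b i.castSucc : ℝ) (b i.succ) :=
  mem_Ioo_of_forall_mem_Icc (S.mapsTo i j h) hx

theorem mem_unitInterval {i : Fin q} {x : ℝ} (hx : x ∈ Icc (b i.castSucc : ℝ) (b i.succ)) :
    x ∈ Icc (0 : ℝ) 1 :=
  ⟨(b i.castSucc).2.1.trans hx.1, hx.2.trans (b i.succ).2.2⟩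

theorem exists_of_mem_hat (S : IsBranchSystem τ C b R m d) {x y : unitInterval} {j : Fin q}
    (hy : y ∈ hat τ x) (hj : y ∈ Ioo (b j.castSucc) (b j.succ)) :
    ∃ i, R i j ∧ x ∈ Ioo (b i.castSucc) (b i.succ) ∧ (y : ℝ) = m i * x + d i j :=
  exists_branch_of_mem_hat S.finite S.first S.last S.mapsTo S.of_mem hy hj

/-- Converse of `exists_of_mem_hat`, and valid at endpoints too: `z` is chosen so that the branch
sends it into the open interval, and between `x` and `z` the map `τ` off `C` is the branch. So `y`
is the limit at `x` from the side of `z`. -/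
theorem mem_hat (S : IsBranchSystem τ C b R m d) {x y : unitInterval} {i j : Fin q}
    (h : R i j) (hj : y ∈ Icc (b j.castSucc) (b j.succ)) (hxy : (y : ℝ) = m i * x + d i j) :
    y ∈ hat τ x := by
  have hm := S.slope_ne i
  have hlt := S.cell_lt j
  have hj1 : (b j.castSucc : ℝ) ≤ y := hj.1
  have hj2 : (y : ℝ) ≤ b j.succ := hj.2
  obtain ⟨z, hzx, hzj⟩ : ∃ z : ℝ, z ≠ x ∧
      m i * z + d i j ∈ Ioo (b j.castSucc : ℝ) (b j.succ) := by
    obtain ⟨w, hw, hwy⟩ : ∃ w ∈ Ioo (b j.castSucc : ℝ) (b j.succ), w ≠ y := by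
      rcases hj1.eq_or_lt with h | h
      · obtain ⟨w, h1, h2⟩ := exists_between hlt
        exact ⟨w, ⟨h1, h2⟩, by rw [← h]; exact h1.ne'⟩
      · obtain ⟨w, h1, h2⟩ := exists_between h
        exact ⟨w, ⟨h1, h2.trans_le hj2⟩, h2.ne⟩
    have hw' : m i * ((w - d i j) / m i) + d i j = w := by field_simp; ring
    refine ⟨(w - d i j) / m i, ?_, by rwa [hw']⟩
    rintro hx
    rw [hx] at hw'
    exact hwy (by rw [hxy, hw'])
  have hz01 := mem_unitInterval (Ioo_subset_Icc_self (S.mapsTo_Ioo h hzj))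
  have hbetween : ∀ t : unitInterval, ((x : ℝ) < t ∧ (t : ℝ) < z) ∨ ((t : ℝ) < x ∧ z < t) →
      t ∉ C → (τ t : ℝ) = m i * t + d i j := by
    intro t ht htC
    have hmem : m i * (t : ℝ) + d i j ∈ Ioo (b j.castSucc : ℝ) (b j.succ) := by
      have h1 := hzj.1
      have h2 := hzj.2
      rcases hm.lt_or_gt with hm | hm <;> rcases ht with ⟨ht1, ht2⟩ | ⟨ht1, ht2⟩ <;>
        constructor <;> nlinarith
    exact S.apply i j h t ⟨S.mapsTo_Ioo h hmem, htC⟩ hmem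
  have hlim : Tendsto (fun t : unitInterval => m i * (t : ℝ) + d i j) (𝓝 x) (𝓝 (y : ℝ)) := by
    rw [hxy]
    exact Continuous.tendsto (by fun_prop) x
  have hC := eventually_notMem_of_finite S.finite x
  rcases hzx.lt_or_gt with hzx | hzx
  · have hz : (⟨z, hz01⟩ : unitInterval) < x := hzx
    refine Or.inl ⟨lt_of_le_of_lt unitInterval.nonneg' hz, tendsto_subtype_rng.2 ?_⟩
    refine (hlim.mono_left nhdsWithin_le_nhds).congr' ?_
    filter_upwards [Ioo_mem_nhdsLT hz, hC.filter_mono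
      (nhdsWithin_mono x fun z (hz : z < x) => hz.ne)] with t ht htC
    exact (hbetween t (Or.inr ⟨ht.2, ht.1⟩) htC).symm
  · have hz : x < (⟨z, hz01⟩ : unitInterval) := hzx
    refine Or.inr ⟨lt_of_lt_of_le hz unitInterval.le_one', tendsto_subtype_rng.2 ?_⟩
    refine (hlim.mono_left nhdsWithin_le_nhds).congr' ?_
    filter_upwards [Ioo_mem_nhdsGT hz, hC.filter_mono
      (nhdsWithin_mono x fun z (hz : x < z) => hz.ne')] with t ht htC
    exact (hbetween t (Or.inl ⟨ht.1, ht.2⟩) htC).symm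

theorem rel_iff (S : IsBranchSystem τ C b R m d) (i j : Fin q) :
    R i j ↔ Ioo (b j.castSucc) (b j.succ) ⊆ hatImage τ (Ioo (b i.castSucc) (b i.succ)) := by
  have hm := S.slope_ne i
  constructor
  · intro h y hy
    have hw' : m i * ((y - d i j) / m i) + d i j = y := by field_simp; ring
    have hx : (y - d i j) / m i ∈ Ioo (b i.castSucc : ℝ) (b i.succ) :=
      S.mapsTo_Ioo h (by rw [hw']; exact hy)
    exact mem_hatImage.2 ⟨⟨_, mem_unitInterval (Ioo_subset_Icc_self hx)⟩, hx,
      S.mem_hat h (Ioo_subset_Icc_self hy) hw'.symm⟩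
  · intro h
    obtain ⟨y, hy⟩ := exists_between (S.strictMono (Fin.castSucc_lt_succ (i := j)))
    obtain ⟨x, hx, hxy⟩ := mem_hatImage.1 (h hy)
    obtain ⟨i', hR, hx', -⟩ := S.exists_of_mem_hat hxy hy
    rwa [eq_of_mem_Ioo_of_mem_Icc S.strictMono hx (Ioo_subset_Icc_self hx')]

theorem hat_subset_range (S : IsBranchSystem τ C b R m d) {x y : unitInterval}
    (hx : x ∈ range b) (hy : y ∈ hat τ x) : y ∈ range b := by
  by_contra hyB
  obtain ⟨j, hj⟩ := exists_mem_Ioo_of_partition S.first S.last hyB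
  obtain ⟨i, -, hxi, -⟩ := S.exists_of_mem_hat hy hj
  exact notMem_range_of_mem_Ioo S.strictMono hxi hx

theorem range_subset_orbit (S : IsBranchSystem τ C b R m d) :
    range b ⊆ generalizedOrbit τ C := by
  rintro _ ⟨i, rfl⟩
  exact S.mem_orbit i

theorem apply_notMem_orbit (S : IsBranchSystem τ C b R m d) {x : unitInterval}
    (hx : x ∉ generalizedOrbit τ C) : τ x ∉ generalizedOrbit τ C := fun h =>
  hx (InGeneralizedOrbit.preimage h
    (by rw [S.hat_eq x fun hC => hx (InGeneralizedOrbit.base hC)]; rfl))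

theorem iterate_notMem_orbit (S : IsBranchSystem τ C b R m d) {x : unitInterval}
    (hx : x ∉ generalizedOrbit τ C) (k : ℕ) : τ^[k] x ∉ generalizedOrbit τ C := by
  induction k with
  | zero => exact hx
  | succ k ih =>
    rw [Function.iterate_succ_apply']
    exact S.apply_notMem_orbit ih

theorem exists_notMem_orbit_of_lt (S : IsBranchSystem τ C b R m d) {p r : ℝ} (hp : 0 ≤ p)
    (hpr : p < r) (hr : r ≤ 1) :
    ∃ x : unitInterval, (x : ℝ) ∈ Ioo p r ∧ x ∉ generalizedOrbit τ C := by
  have hd := (S.countable_orbit.image (Subtype.val : unitInterval → ℝ)).dense_compl ℝ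
  obtain ⟨x, hx, hxC⟩ := hd.inter_open_nonempty _ isOpen_Ioo (nonempty_Ioo.2 hpr)
  exact ⟨⟨x, hp.trans hx.1.le, hx.2.le.trans hr⟩, hx, fun h => hxC ⟨_, h, rfl⟩⟩

theorem exists_notMem_orbit (S : IsBranchSystem τ C b R m d) {U : Set unitInterval}
    (hU : IsOpen U) (hne : U.Nonempty) : ∃ x ∈ U, x ∉ generalizedOrbit τ C := by
  obtain ⟨p, r, hpr, hs⟩ := hU.exists_Ioo_subset hne
  obtain ⟨x, hx, hxC⟩ := S.exists_notMem_orbit_of_lt p.2.1 hpr r.2.2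
  exact ⟨x, hs hx, hxC⟩

end IsBranchSystem

/-! ### Cylinders and their contraction -/

/-- The composition of the first `k` affine branches along the sequence `s`. -/
def forward {q : ℕ} (m : Fin q → ℝ) (d : Fin q → Fin q → ℝ) (s : ℕ → Fin q) : ℕ → ℝ → ℝ
  | 0, x => x
  | k + 1, x => m (s k) * forward m d s k x + d (s k) (s (k + 1))

/-- The closed cylinder of the first `k + 1` letters of `s`. -/
def cylinder {q : ℕ} (b : Fin (q + 1) → unitInterval) (m : Fin q → ℝ) (d : Fin q → Fin q → ℝ)
    (s : ℕ → Fin q) (k : ℕ) : Set ℝ :=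
  {x | forward m d s k x ∈ Icc (b (s k).castSucc : ℝ) (b (s k).succ)}

section Forward

variable {q : ℕ} {b : Fin (q + 1) → unitInterval} {m : Fin q → ℝ} {d : Fin q → Fin q → ℝ}

theorem forward_eq (m : Fin q → ℝ) (d : Fin q → Fin q → ℝ) (s : ℕ → Fin q) (k : ℕ) (x : ℝ) :
    forward m d s k x = (∏ l ∈ Finset.range k, m (s l)) * x + forward m d s k 0 := by
  induction k with
  | zero => simp [forward]
  | succ k ih =>
    simp only [forward, Finset.prod_range_succ]
    rw [ih]; ring

theorem forward_succ (m : Fin q → ℝ) (d : Fin q → Fin q → ℝ) (s : ℕ → Fin q) (k : ℕ) (x : ℝ) :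
    forward m d s (k + 1) x =
      forward m d (fun l => s (l + 1)) k (m (s 0) * x + d (s 0) (s 1)) := by
  induction k with
  | zero => rfl
  | succ k ih => rw [forward, ih]; rfl

theorem forward_congr {s t : ℕ → Fin q} {k : ℕ} (h : ∀ l ≤ k, s l = t l) (x : ℝ) :
    forward m d s k x = forward m d t k x := by
  induction k with
  | zero => rfl
  | succ k ih =>
    rw [forward, forward, ih fun l hl => h l (by omega), h k (by omega), h (k + 1) le_rfl]

theorem cylinder_congr {s t : ℕ → Fin q} {k : ℕ} (h : ∀ l ≤ k, s l = t l) :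
    cylinder b m d s k = cylinder b m d t k := by
  ext x
  rw [cylinder, cylinder, mem_ofPred_eq, mem_ofPred_eq, forward_congr h, h k le_rfl]

end Forward

namespace IsBranchSystem

variable {τ : unitInterval → unitInterval} {C : Set unitInterval} {q : ℕ}
  {b : Fin (q + 1) → unitInterval} {R : Fin q → Fin q → Prop} {m : Fin q → ℝ}
  {d : Fin q → Fin q → ℝ}

theorem prod_ne_zero (S : IsBranchSystem τ C b R m d) (s : ℕ → Fin q) (k : ℕ) :
    ∏ l ∈ Finset.range k, m (s l) ≠ 0 :=
  Finset.prod_ne_zero_iff.2 fun _ _ => S.slope_ne _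

theorem cylinder_interval (S : IsBranchSystem τ C b R m d) (s : ℕ → Fin q) (k : ℕ) :
    ∃ p r, p < r ∧ (∀ x, forward m d s k x ∈ Ioo (b (s k).castSucc : ℝ) (b (s k).succ) ↔
        x ∈ Ioo p r) ∧ cylinder b m d s k = Icc p r ∧
      |∏ l ∈ Finset.range k, m (s l)| * (r - p) = b (s k).succ - b (s k).castSucc := by
  obtain ⟨p, r, h1, h2, h3, h4⟩ := preimage_affine (e := forward m d s k 0) (S.prod_ne_zero s k)
    (S.cell_lt (s k))
  refine ⟨p, r, h1, fun x => ?_, ?_, h4⟩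
  · rw [forward_eq, h2]
  · ext x
    rw [cylinder, mem_ofPred_eq, forward_eq, h3]

theorem cylinder_succ_subset (S : IsBranchSystem τ C b R m d) {s : ℕ → Fin q}
    (hs : ∀ k, R (s k) (s (k + 1))) (k : ℕ) : cylinder b m d s (k + 1) ⊆ cylinder b m d s k :=
  fun _ hx => S.mapsTo _ _ (hs k) _ hx

theorem cylinder_antitone (S : IsBranchSystem τ C b R m d) {s : ℕ → Fin q}
    (hs : ∀ k, R (s k) (s (k + 1))) : Antitone (cylinder b m d s) :=
  antitone_nat_of_succ_le (S.cylinder_succ_subset hs)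

theorem cylinder_subset_unitInterval (S : IsBranchSystem τ C b R m d) {s : ℕ → Fin q}
    (hs : ∀ k, R (s k) (s (k + 1))) (k : ℕ) : cylinder b m d s k ⊆ Icc 0 1 := fun _ hx =>
  mem_unitInterval (S.cylinder_antitone hs (Nat.zero_le k) hx)

theorem forward_mem_Ioo (S : IsBranchSystem τ C b R m d) {s : ℕ → Fin q}
    (hs : ∀ k, R (s k) (s (k + 1))) {k l : ℕ} (hl : l ≤ k) {x : ℝ}
    (hx : forward m d s k x ∈ Ioo (b (s k).castSucc : ℝ) (b (s k).succ)) :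
    forward m d s l x ∈ Ioo (b (s l).castSucc : ℝ) (b (s l).succ) := by
  induction k, hl using Nat.le_induction with
  | base => exact hx
  | succ k _ ih => exact ih (S.mapsTo_Ioo (hs k) hx)

theorem iterate_eq_forward (S : IsBranchSystem τ C b R m d) {s : ℕ → Fin q}
    (hs : ∀ k, R (s k) (s (k + 1))) {k : ℕ} {x : unitInterval}
    (hxC : x ∉ generalizedOrbit τ C)
    (hx : forward m d s k x ∈ Ioo (b (s k).castSucc : ℝ) (b (s k).succ)) :
    (τ^[k] x : ℝ) = forward m d s k x := by
  induction k with
  | zero => rfl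
  | succ k ih =>
    have h1 := S.forward_mem_Ioo hs (Nat.le_succ k) hx
    have h2 := ih h1
    rw [Function.iterate_succ_apply', forward, ← h2]
    refine S.apply _ _ (hs k) _ ⟨?_, fun h =>
      S.iterate_notMem_orbit hxC k (InGeneralizedOrbit.base h)⟩ ?_
    · rw [← h2] at h1
      exact h1
    · rw [h2]
      exact hx

theorem mem_iterate_hatImage (S : IsBranchSystem τ C b R m d) {s : ℕ → Fin q}
    (hs : ∀ k, R (s k) (s (k + 1))) {k : ℕ} {x y : unitInterval}
    (hxy : (y : ℝ) = forward m d s k x) (hy : y ∈ Icc (b (s k).castSucc) (b (s k).succ)) :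
    y ∈ (hatImage τ)^[k] {x} := by
  induction k generalizing y with
  | zero => exact Subtype.ext hxy
  | succ k ih =>
    have hx : (x : ℝ) ∈ cylinder b m d s (k + 1) := by
      rw [cylinder, mem_ofPred_eq, ← hxy]
      exact hy
    have hz := S.cylinder_succ_subset hs k hx
    rw [Function.iterate_succ_apply']
    exact mem_hatImage.2 ⟨⟨_, mem_unitInterval hz⟩, ih rfl hz, S.mem_hat (hs k) hy hxy⟩

/-- A common interior point could be taken off the orbit, where both compositions equal `τ^[k]`; its
image would lie in two different open Markov intervals. -/
theorem disjoint_interiors (S : IsBranchSystem τ C b R m d) {s t : ℕ → Fin q}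
    (hs : ∀ k, R (s k) (s (k + 1))) (ht : ∀ k, R (t k) (t (k + 1))) {k : ℕ} (hne : s k ≠ t k)
    {p r p' r' : ℝ} (hpr : p < r) (hpr' : p' < r')
    (h : ∀ x, forward m d s k x ∈ Ioo (b (s k).castSucc : ℝ) (b (s k).succ) ↔ x ∈ Ioo p r)
    (h' : ∀ x, forward m d t k x ∈ Ioo (b (t k).castSucc : ℝ) (b (t k).succ) ↔ x ∈ Ioo p' r')
    (hp : 0 ≤ p) (hr : r ≤ 1) : r ≤ p' ∨ r' ≤ p := by
  by_contra! hc
  obtain ⟨x, hx, hxC⟩ := S.exists_notMem_orbit_of_lt (p := max p p') (r := min r r')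
    (hp.trans (le_max_left _ _)) (max_lt (lt_min hpr hc.2) (lt_min hc.1 hpr'))
    ((min_le_left _ _).trans hr)
  have h1 := (h x).2 ⟨(le_max_left _ _).trans_lt hx.1, hx.2.trans_le (min_le_left _ _)⟩
  have h2 := (h' x).2 ⟨(le_max_right _ _).trans_lt hx.1, hx.2.trans_le (min_le_right _ _)⟩
  rw [← S.iterate_eq_forward hs hxC h1] at h1
  rw [← S.iterate_eq_forward ht hxC h2] at h2
  exact hne (eq_of_mem_Ioo_of_mem_Icc S.strictMono h1 (Ioo_subset_Icc_self h2))

theorem length_le (S : IsBranchSystem τ C b R m d) {i j : Fin q} (h : R i j) :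
    (b j.succ - b j.castSucc : ℝ) ≤ |m i| * (b i.succ - b i.castSucc) := by
  obtain ⟨p, r, h1, -, h3, h4⟩ := preimage_affine (e := d i j) (S.slope_ne i) (S.cell_lt j)
  have hp := S.mapsTo i j h p ((h3 p).2 ⟨le_rfl, h1.le⟩)
  have hr := S.mapsTo i j h r ((h3 r).2 ⟨h1.le, le_rfl⟩)
  rw [← h4]
  exact mul_le_mul_of_nonneg_left (by linarith [hp.1, hr.2]) (abs_nonneg _)

/-- The preimages of the two target intervals are non-overlapping subintervals of the `i`-th one. -/
theorem length_add_le (S : IsBranchSystem τ C b R m d) {i j j' : Fin q} (h : R i j)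
    (h' : R i j') (hne : j ≠ j') :
    (b j.succ - b j.castSucc : ℝ) + (b j'.succ - b j'.castSucc) ≤
      |m i| * (b i.succ - b i.castSucc) := by
  obtain ⟨p, r, h1, h2, h3, h4⟩ := preimage_affine (e := d i j) (S.slope_ne i) (S.cell_lt j)
  obtain ⟨p', r', h1', h2', h3', h4'⟩ :=
    preimage_affine (e := d i j') (S.slope_ne i) (S.cell_lt j')
  have hp := S.mapsTo i j h p ((h3 p).2 ⟨le_rfl, h1.le⟩)
  have hr := S.mapsTo i j h r ((h3 r).2 ⟨h1.le, le_rfl⟩)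
  have hp' := S.mapsTo i j' h' p' ((h3' p').2 ⟨le_rfl, h1'.le⟩)
  have hr' := S.mapsTo i j' h' r' ((h3' r').2 ⟨h1'.le, le_rfl⟩)
  have hdisj : r ≤ p' ∨ r' ≤ p := by
    by_contra! hc
    obtain ⟨x, hx, hxC⟩ := S.exists_notMem_orbit_of_lt (p := max p p') (r := min r r')
      ((mem_unitInterval hp).1.trans (le_max_left _ _))
      (max_lt (lt_min h1 hc.2) (lt_min hc.1 h1'))
      ((min_le_left _ _).trans (mem_unitInterval hr).2)
    have e := (h2 x).2 ⟨(le_max_left _ _).trans_lt hx.1, hx.2.trans_le (min_le_left _ _)⟩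
    have e' := (h2' x).2 ⟨(le_max_right _ _).trans_lt hx.1, hx.2.trans_le (min_le_right _ _)⟩
    have hxi : x ∈ Ioo (b i.castSucc) (b i.succ) \ C :=
      ⟨S.mapsTo_Ioo h e, fun hC => hxC (InGeneralizedOrbit.base hC)⟩
    rw [← S.apply i j h x hxi e] at e
    rw [← S.apply i j' h' x hxi e'] at e'
    exact hne (eq_of_mem_Ioo_of_mem_Icc S.strictMono (x := τ x) e (Ioo_subset_Icc_self e'))
  rw [← h4, ← h4', ← mul_add]
  refine mul_le_mul_of_nonneg_left ?_ (abs_nonneg _)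
  rcases hdisj with h | h <;> linarith [hp.1, hr.2, hp'.1, hr'.2]

theorem exists_contraction (S : IsBranchSystem τ C b R m d) :
    ∃ ρ : ℝ, 0 ≤ ρ ∧ ρ < 1 ∧ ∀ i j j', R i j → R i j' → j ≠ j' →
      (b j.succ - b j.castSucc : ℝ) ≤ ρ * (|m i| * (b i.succ - b i.castSucc)) := by
  have hpos : ∀ i : Fin q, 0 < (b i.succ - b i.castSucc : ℝ) := fun i => sub_pos.2 (S.cell_lt i)
  have hpos' : ∀ i : Fin q, 0 < |m i| * (b i.succ - b i.castSucc : ℝ) := fun i =>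
    mul_pos (abs_pos.2 (S.slope_ne i)) (hpos i)
  -- The least share that a second successor can take of the stretched length `|m i| * |E_i|`; the
  -- factor is then `1 - ε`, truncated at `0`.
  obtain ⟨ε, hε, hε'⟩ : ∃ ε : ℝ, 0 < ε ∧ ∀ z : Fin q × Fin q,
      ε ≤ (b z.2.succ - b z.2.castSucc : ℝ) / (|m z.1| * (b z.1.succ - b z.1.castSucc)) := by
    rcases isEmpty_or_nonempty (Fin q × Fin q) with hq | hq
    · exact ⟨1, one_pos, fun z => (hq.false z).elim⟩
    · obtain ⟨z, hz⟩ := Finite.exists_min fun z : Fin q × Fin q =>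
        (b z.2.succ - b z.2.castSucc : ℝ) / (|m z.1| * (b z.1.succ - b z.1.castSucc))
      exact ⟨_, div_pos (hpos _) (hpos' _), hz⟩
  refine ⟨max 0 (1 - ε), le_max_left _ _, max_lt one_pos (by linarith), fun i j j' h h' hne => ?_⟩
  have h1 := S.length_add_le h h' hne
  have h2 := (le_div_iff₀ (hpos' i)).1 (hε' (i, j'))
  have h3 := mul_le_mul_of_nonneg_right (le_max_right 0 (1 - ε)) (hpos' i).le
  simp only at h2
  linarith

/-- Every admissible sequence passes infinitely often through a vertex with several successors. -/
def Branching (R : Fin q → Fin q → Prop) : Prop :=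
  ∀ s : ℕ → Fin q, (∀ k, R (s k) (s (k + 1))) → ∀ k, ∃ l ≥ k, ∃ j, R (s l) j ∧ s (l + 1) ≠ j

theorem exists_cylinder_small (S : IsBranchSystem τ C b R m d) (hR : Branching R)
    {s : ℕ → Fin q} (hs : ∀ k, R (s k) (s (k + 1))) {ε : ℝ} (hε : 0 < ε) :
    ∃ k, ∀ x ∈ cylinder b m d s k, ∀ y ∈ cylinder b m d s k, |x - y| < ε := by
  obtain ⟨ρ, hρ0, hρ1, hρ⟩ := S.exists_contraction
  set M : ℕ → ℝ := fun k => |∏ l ∈ Finset.range k, m (s l)|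
  have hM : ∀ k, 0 < M k := fun k => abs_pos.2 (S.prod_ne_zero s k)
  have hMs : ∀ k, M (k + 1) = M k * |m (s k)| := fun k => by
    simp only [M, Finset.prod_range_succ, abs_mul]
  -- `L k` is the length of the `k`-th cylinder.
  set L : ℕ → ℝ := fun k => (b (s k).succ - b (s k).castSucc) / M k
  have hL : Antitone L := antitone_nat_of_succ_le fun k => by
    have := S.length_le (hs k)
    have hk := hM k
    have hmk := abs_pos.2 (S.slope_ne (s k))
    simp only [L, hMs]
    rw [div_le_div_iff₀ (by positivity) hk]
    nlinarith
  have hLρ : ∀ k, ∃ l, L l ≤ ρ * L k := by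
    intro k
    obtain ⟨l, hl, j, hj, hne⟩ := hR s hs k
    refine ⟨l + 1, le_trans ?_ (mul_le_mul_of_nonneg_left (hL hl) hρ0)⟩
    have := hρ _ _ _ (hs l) hj hne
    have hk := hM l
    have hmk := abs_pos.2 (S.slope_ne (s l))
    simp only [L, hMs]
    rw [← mul_div_assoc, div_le_div_iff₀ (by positivity) hk]
    nlinarith
  have hLN : ∀ N : ℕ, ∃ l, L l ≤ ρ ^ N * L 0 := by
    intro N
    induction N with
    | zero => exact ⟨0, by simp⟩
    | succ N ih =>
      obtain ⟨k, hk⟩ := ih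
      obtain ⟨l, hl⟩ := hLρ k
      refine ⟨l, hl.trans ?_⟩
      rw [pow_succ', mul_assoc]
      exact mul_le_mul_of_nonneg_left hk hρ0
  have hlim : Tendsto (fun N : ℕ => ρ ^ N * L 0) atTop (𝓝 0) := by
    simpa using (tendsto_pow_atTop_nhds_zero_of_lt_one hρ0 hρ1).mul_const (L 0)
  obtain ⟨N, hN⟩ := (hlim.eventually (gt_mem_nhds hε)).exists
  obtain ⟨k, hk⟩ := hLN N
  obtain ⟨p, r, hpr, -, hc, hlen⟩ := S.cylinder_interval s k
  have hrp : r - p = L k := by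
    rw [eq_div_iff (hM k).ne', mul_comm]
    exact hlen
  refine ⟨k, fun x hx y hy => ?_⟩
  rw [hc] at hx hy
  rw [abs_lt]
  constructor <;> linarith [hx.1, hx.2, hy.1, hy.2]

/-- The point `x` has the itinerary `s`. -/
def Codes (b : Fin (q + 1) → unitInterval) (m : Fin q → ℝ) (d : Fin q → Fin q → ℝ)
    (s : ℕ → Fin q) (x : ℝ) : Prop :=
  ∀ k, x ∈ cylinder b m d s k

theorem exists_codes (S : IsBranchSystem τ C b R m d) {s : ℕ → Fin q}
    (hs : ∀ k, R (s k) (s (k + 1))) : ∃ x, Codes b m d s x := by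
  have h : (⋂ k, cylinder b m d s k).Nonempty := by
    refine IsCompact.nonempty_iInter_of_sequence_nonempty_isCompact_isClosed _
      (S.cylinder_succ_subset hs) (fun k => ?_) ?_ fun k => ?_
    all_goals obtain ⟨p, r, hpr, -, hc, -⟩ := S.cylinder_interval s (by first | exact k | exact 0)
    · rw [hc]; exact nonempty_Icc.2 hpr.le
    · rw [hc]; exact isCompact_Icc
    · rw [hc]; exact isClosed_Icc
  obtain ⟨x, hx⟩ := h
  exact ⟨x, fun k => mem_iInter.1 hx k⟩

theorem codes_unique (S : IsBranchSystem τ C b R m d) (hR : Branching R) {s : ℕ → Fin q}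
    (hs : ∀ k, R (s k) (s (k + 1))) {x y : ℝ} (hx : Codes b m d s x) (hy : Codes b m d s y) :
    x = y := by
  by_contra hne
  obtain ⟨k, hk⟩ := S.exists_cylinder_small hR hs (abs_pos.2 (sub_ne_zero.2 hne))
  exact lt_irrefl _ (hk x (hx k) y (hy k))

theorem Codes.shift {s : ℕ → Fin q} {x : ℝ} (hx : Codes b m d s x) :
    Codes b m d (fun k => s (k + 1)) (m (s 0) * x + d (s 0) (s 1)) := fun k => by
  have := hx (k + 1)
  rwa [cylinder, mem_ofPred_eq, forward_succ] at this

theorem exists_itinerary (S : IsBranchSystem τ C b R m d) {x : unitInterval}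
    (hx : x ∉ generalizedOrbit τ C) :
    ∃ s : ℕ → Fin q, (∀ k, R (s k) (s (k + 1))) ∧ Codes b m d s x := by
  have hcell : ∀ k, ∃ i : Fin q, τ^[k] x ∈ Ioo (b i.castSucc) (b i.succ) := fun k =>
    exists_mem_Ioo_of_partition S.first S.last fun h =>
      S.iterate_notMem_orbit hx k (S.range_subset_orbit h)
  choose s hs using hcell
  have hstep : ∀ k, R (s k) (s (k + 1)) ∧
      (τ^[k + 1] x : ℝ) = m (s k) * τ^[k] x + d (s k) (s (k + 1)) := fun k => by
    have h := hs (k + 1)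
    rw [Function.iterate_succ_apply'] at h ⊢
    exact S.of_mem _ _ _
      ⟨hs k, fun hC => S.iterate_notMem_orbit hx k (InGeneralizedOrbit.base hC)⟩ h
  have hfor : ∀ k, forward m d s k x = τ^[k] x := fun k => by
    induction k with
    | zero => rfl
    | succ k ih => rw [forward, ih, (hstep k).2]
  refine ⟨s, fun k => (hstep k).1, fun k => ?_⟩
  rw [cylinder, mem_ofPred_eq, hfor]
  exact Ioo_subset_Icc_self (hs k)

/-- A small enough cylinder around a point of `U` off the orbit lies in `U`, and `forward` carries
it onto a whole closed Markov interval. -/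
theorem exists_Icc_subset_iterate (S : IsBranchSystem τ C b R m d) (hR : Branching R)
    {U : Set unitInterval} (hU : IsOpen U) (hne : U.Nonempty) :
    ∃ k, ∃ i : Fin q, Icc (b i.castSucc) (b i.succ) ⊆ (hatImage τ)^[k] U := by
  obtain ⟨x, hxU, hxC⟩ := S.exists_notMem_orbit hU hne
  obtain ⟨s, hs, hc⟩ := S.exists_itinerary hxC
  obtain ⟨ε, hε, hball⟩ := Metric.isOpen_iff.1 hU x hxU
  obtain ⟨k, hk⟩ := S.exists_cylinder_small hR hs hε
  refine ⟨k, s k, fun y hy => ?_⟩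
  set M := ∏ l ∈ Finset.range k, m (s l)
  have hM : M ≠ 0 := S.prod_ne_zero s k
  set z := ((y : ℝ) - forward m d s k 0) / M with hz
  have hzy : (y : ℝ) = forward m d s k z := by
    rw [forward_eq, hz]
    field_simp
    ring
  have hzc : z ∈ cylinder b m d s k := by
    rw [cylinder, mem_ofPred_eq, ← hzy]
    exact hy
  have hz01 := S.cylinder_subset_unitInterval hs k hzc
  have hzU : (⟨z, hz01⟩ : unitInterval) ∈ U := hball (hk _ hzc _ (hc k))
  exact (hatImage_mono τ).iterate k (singleton_subset_iff.2 hzU)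
    (S.mem_iterate_hatImage hs hzy hy)

end IsBranchSystem

/-! ### Zero-one matrices: primitivity, irreducibility and branching -/

theorem pow_succ_pos_iff {q : ℕ} {A : Matrix (Fin q) (Fin q) ℤ} (hA : ∀ i j, 0 ≤ A i j) (k : ℕ)
    (i j : Fin q) : 0 < (A ^ (k + 1)) i j ↔ ∃ l, 0 < (A ^ k) i l ∧ 0 < A l j := by
  have hk : ∀ i j, 0 ≤ (A ^ k) i j := Matrix.pow_apply_nonneg hA k
  rw [pow_succ, Matrix.mul_apply,
    Finset.sum_pos_iff_of_nonneg fun l _ => mul_nonneg (hk i l) (hA l j)]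
  constructor
  · rintro ⟨l, -, hl⟩
    exact ⟨l, pos_of_mul_pos_left hl (hA l j), pos_of_mul_pos_right hl (hk i l)⟩
  · rintro ⟨l, h1, h2⟩
    exact ⟨l, Finset.mem_univ l, mul_pos h1 h2⟩

theorem permMatrix_apply_eq_ite {q : ℕ} (p : Equiv.Perm (Fin q)) (i j : Fin q) :
    p.permMatrix ℤ i j = if p i = j then 1 else 0 := by
  rw [Equiv.Perm.permMatrix, PEquiv.toMatrix_apply]
  by_cases h : p i = j <;> simp [h]

theorem permMatrix_pos_iff {q : ℕ} (p : Equiv.Perm (Fin q)) (i j : Fin q) :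
    0 < p.permMatrix ℤ i j ↔ p i = j := by
  rw [permMatrix_apply_eq_ite]
  split_ifs <;> simp_all

/-- Each row of a power of a permutation matrix has only one positive entry. For `q = 1` the matrix
`(1)` is both primitive and a permutation matrix. -/
theorem not_isPermutationMatrix_of_isPrimitive {q : ℕ} (hq : 2 ≤ q)
    {A : Matrix (Fin q) (Fin q) ℤ} (hA : A.IsPrimitive) : ¬ IsPermutationMatrix A := by
  rintro ⟨p, rfl⟩
  obtain ⟨k, -, hk⟩ := hA.exists_pos_pow
  have h : ∀ k i j, 0 < (p.permMatrix ℤ ^ k) i j → p^[k] i = j := by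
    intro k
    induction k with
    | zero =>
      intro i j h
      by_contra hij
      simp only [Function.iterate_zero, id] at hij
      simp [hij] at h
    | succ k ih =>
      intro i j h
      obtain ⟨l, h1, h2⟩ := (pow_succ_pos_iff hA.nonneg k i j).1 h
      rw [Function.iterate_succ_apply', ih i l h1]
      exact (permMatrix_pos_iff p l j).1 h2
  have h01 := (h k ⟨0, by omega⟩ _ (hk _ ⟨0, by omega⟩)).symm.trans
    (h k ⟨0, by omega⟩ _ (hk _ ⟨1, by omega⟩))
  simp at h01

/-- If a path stops branching, everything reachable from it lies on it; by irreducibility every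
vertex then has one successor. Every vertex also has a predecessor, so the successor map is a
surjection of a finite set, that is, a permutation. -/
theorem branching_of_isIrreducible {q : ℕ} {A : Matrix (Fin q) (Fin q) ℤ}
    (h01 : ∀ i j, A i j = 0 ∨ A i j = 1) (hA : A.IsIrreducible)
    (hp : ¬ IsPermutationMatrix A) : IsBranchSystem.Branching fun i j => A i j = 1 := by
  have hpos : ∀ i j, 0 < A i j ↔ A i j = 1 := fun i j => by
    rcases h01 i j with h | h <;> simp [h]
  have hconn := (Matrix.isIrreducible_iff_exists_pow_pos hA.nonneg).1 hA
  intro s hs k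
  by_contra! hc
  have hreach : ∀ n i, 0 < (A ^ n) (s k) i → s (k + n) = i := by
    intro n
    induction n with
    | zero =>
      intro i h
      by_contra hij
      simp only [Nat.add_zero] at hij
      simp [hij] at h
    | succ n ih =>
      intro i h
      obtain ⟨l, h1, h2⟩ := (pow_succ_pos_iff hA.nonneg n _ i).1 h
      obtain rfl := ih l h1
      exact hc (k + n) (by omega) i ((hpos _ _).1 h2)
  have huniq : ∀ i, ∃ j, A i j = 1 ∧ ∀ j', A i j' = 1 → j = j' := by
    intro i
    obtain ⟨n, -, hn⟩ := hconn (s k) i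
    obtain rfl := hreach n i hn
    exact ⟨s (k + n + 1), hs _, fun j' h => hc _ (by omega) j' h⟩
  choose f hf hf' using huniq
  have hsurj : Function.Surjective f := by
    intro j
    obtain ⟨n, hn, h⟩ := hconn j j
    obtain ⟨n, rfl⟩ := Nat.exists_eq_succ_of_ne_zero hn.ne'
    obtain ⟨l, -, h2⟩ := (pow_succ_pos_iff hA.nonneg n _ j).1 h
    exact ⟨l, hf' l j ((hpos _ _).1 h2)⟩
  obtain ⟨e, he⟩ : ∃ e : Equiv.Perm (Fin q), ∀ i, e i = f i :=
    ⟨Equiv.ofBijective f ⟨Finite.injective_iff_surjective.2 hsurj, hsurj⟩, fun _ => rfl⟩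
  refine hp ⟨e, Matrix.ext fun i j => ?_⟩
  rw [permMatrix_apply_eq_ite, he]
  split_ifs with h
  · exact h ▸ hf i
  · exact (h01 i j).resolve_right fun h' => h (hf' i j h')

theorem partialImage_subset_hatImage {τ : unitInterval → unitInterval} {C : Set unitInterval}
    (h : ∀ x ∉ C, hat τ x = {τ x}) (U : Set unitInterval) :
    partialImage τ C U ⊆ hatImage τ U := by
  rintro _ ⟨x, hx, rfl⟩
  exact mem_hatImage.2 ⟨x, hx.1, by rw [h x hx.2]; rfl⟩

theorem iterate_partialImage_subset {τ : unitInterval → unitInterval} {C : Set unitInterval}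
    (h : ∀ x ∉ C, hat τ x = {τ x}) (k : ℕ) (U : Set unitInterval) :
    (partialImage τ C)^[k] U ⊆ (hatImage τ)^[k] U := by
  induction k with
  | zero => exact Subset.rfl
  | succ k ih =>
    rw [Function.iterate_succ_apply', Function.iterate_succ_apply']
    exact (partialImage_subset_hatImage h _).trans (hatImage_mono τ ih)

/-- The orbit is closed under `τ̂`, so all predecessors of `y` are off it as well, and there `τ̂` is
`τ`. -/
theorem mem_iterate_partialImage {τ : unitInterval → unitInterval} {C : Set unitInterval}
    (h : ∀ x ∉ C, hat τ x = {τ x}) {k : ℕ} {U : Set unitInterval} {y : unitInterval}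
    (hy : y ∉ generalizedOrbit τ C) (hU : y ∈ (hatImage τ)^[k] U) :
    y ∈ (partialImage τ C)^[k] U := by
  induction k generalizing y with
  | zero => exact hU
  | succ k ih =>
    rw [Function.iterate_succ_apply'] at hU ⊢
    obtain ⟨x, hx, hxy⟩ := mem_hatImage.1 hU
    have hxo : x ∉ generalizedOrbit τ C := fun hx => hy (InGeneralizedOrbit.image hx hxy)
    have hxC : x ∉ C := fun hx => hxo (InGeneralizedOrbit.base hx)
    rw [h x hxC] at hxy
    exact ⟨x, ⟨ih hxo hx, hxC⟩, hxy.symm⟩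

theorem incidenceMatrix_eq_one_iff (τ : unitInterval → unitInterval) {q : ℕ}
    (b : Fin (q + 1) → unitInterval) (i j : Fin q) : incidenceMatrix τ b i j = 1 ↔
      Ioo (b j.castSucc) (b j.succ) ⊆ hatImage τ (Ioo (b i.castSucc) (b i.succ)) := by
  simp [incidenceMatrix]

theorem incidenceMatrix_eq_zero_or_one (τ : unitInterval → unitInterval) {q : ℕ}
    (b : Fin (q + 1) → unitInterval) (i j : Fin q) :
    incidenceMatrix τ b i j = 0 ∨ incidenceMatrix τ b i j = 1 := by
  rw [incidenceMatrix, Matrix.of_apply]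
  split_ifs <;> simp

/-! ### Exactness and transitivity in terms of the incidence matrix -/

namespace IsBranchSystem

variable {τ : unitInterval → unitInterval} {C : Set unitInterval} {q : ℕ}
  {b : Fin (q + 1) → unitInterval} {A : Matrix (Fin q) (Fin q) ℤ} {m : Fin q → ℝ}
  {d : Fin q → Fin q → ℝ}

theorem exists_mem_Icc (S : IsBranchSystem τ C b (fun i j => A i j = 1) m d)
    (x : unitInterval) : ∃ i : Fin q, x ∈ Icc (b i.castSucc) (b i.succ) := by
  rcases eq_or_lt_of_le (unitInterval.le_one' (t := x)) with h | h
  · obtain ⟨i, hi⟩ := exists_mem_Ioc_of_partition (b := b) (x := x)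
      (by rw [S.first, h]; exact zero_lt_one) (by rw [S.last, h])
    exact ⟨i, Ioc_subset_Icc_self hi⟩
  · obtain ⟨i, hi⟩ := exists_mem_Ico_of_partition (b := b) (x := x)
      (by rw [S.first]; exact unitInterval.nonneg') (by rwa [S.last])
    exact ⟨i, Ico_subset_Icc_self hi⟩

theorem Icc_subset_hatImage {R : Fin q → Fin q → Prop} (S : IsBranchSystem τ C b R m d)
    {i j : Fin q} (h : R i j) :
    Icc (b j.castSucc) (b j.succ) ⊆ hatImage τ (Icc (b i.castSucc) (b i.succ)) := by
  intro y hy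
  have hm := S.slope_ne i
  have hw' : m i * ((y - d i j) / m i) + d i j = y := by field_simp; ring
  have hx : (y - d i j) / m i ∈ Icc (b i.castSucc : ℝ) (b i.succ) :=
    S.mapsTo i j h _ (by rw [hw']; exact hy)
  exact mem_hatImage.2 ⟨⟨_, mem_unitInterval hx⟩, hx, S.mem_hat h hy hw'.symm⟩

theorem Icc_subset_iterate (S : IsBranchSystem τ C b (fun i j => A i j = 1) m d)
    (h01 : ∀ i j, A i j = 0 ∨ A i j = 1) {k : ℕ} {i j : Fin q} (h : 0 < (A ^ k) i j) :
    Icc (b j.castSucc) (b j.succ) ⊆ (hatImage τ)^[k] (Icc (b i.castSucc) (b i.succ)) := by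
  have hnn : ∀ i j, 0 ≤ A i j := fun i j => by rcases h01 i j with h | h <;> simp [h]
  induction k generalizing j with
  | zero =>
    by_cases hij : i = j
    · subst hij; exact Subset.rfl
    · simp [hij] at h
  | succ k ih =>
    obtain ⟨l, h1, h2⟩ := (pow_succ_pos_iff hnn k i j).1 h
    rw [Function.iterate_succ_apply']
    exact (S.Icc_subset_hatImage ((h01 l j).resolve_left h2.ne')).trans
      (hatImage_mono τ (ih h1))

theorem pow_pos_of_mem_iterate (S : IsBranchSystem τ C b (fun i j => A i j = 1) m d)
    (h01 : ∀ i j, A i j = 0 ∨ A i j = 1) {k : ℕ} {i j : Fin q} {y : unitInterval}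
    (hy : y ∈ (hatImage τ)^[k] (Ioo (b i.castSucc) (b i.succ)))
    (hj : y ∈ Ioo (b j.castSucc) (b j.succ)) : 0 < (A ^ k) i j := by
  have hnn : ∀ i j, 0 ≤ A i j := fun i j => by rcases h01 i j with h | h <;> simp [h]
  induction k generalizing j y with
  | zero =>
    obtain rfl := eq_of_mem_Ioo_of_mem_Icc S.strictMono hj (Ioo_subset_Icc_self hy)
    simp
  | succ k ih =>
    rw [Function.iterate_succ_apply'] at hy
    obtain ⟨x, hx, hxy⟩ := mem_hatImage.1 hy
    obtain ⟨l, hl, hxl, -⟩ := S.exists_of_mem_hat hxy hj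
    exact (pow_succ_pos_iff hnn k i j).2 ⟨l, ih hx hxl, by rw [hl]; exact one_pos⟩

theorem isTopologicallyExact_iff (S : IsBranchSystem τ C b (fun i j => A i j = 1) m d)
    (h01 : ∀ i j, A i j = 0 ∨ A i j = 1) (hq : 2 ≤ q) :
    IsTopologicallyExact τ ↔ A.IsPrimitive := by
  have hnn : ∀ i j, 0 ≤ A i j := fun i j => by rcases h01 i j with h | h <;> simp [h]
  constructor
  · intro hex
    have hcell : ∀ i : Fin q, ∃ k, (hatImage τ)^[k] (Ioo (b i.castSucc) (b i.succ)) = univ :=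
      fun i => hex _ isOpen_Ioo (exists_between (S.strictMono (Fin.castSucc_lt_succ (i := i))))
    choose k hk using hcell
    -- The open interval misses its left endpoint, so it is not yet everything.
    have hk0 : ∀ i, k i ≠ 0 := fun i h => by
      have h1 := hk i
      rw [h] at h1
      have : b i.castSucc ∈ Ioo (b i.castSucc) (b i.succ) := h1.ge (mem_univ _)
      exact lt_irrefl _ this.1
    have hsurj : hatImage τ univ = univ := by
      obtain ⟨l, hl⟩ := Nat.exists_eq_succ_of_ne_zero (hk0 ⟨0, by omega⟩)
      have h1 := hk ⟨0, by omega⟩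
      rw [hl, Function.iterate_succ_apply'] at h1
      exact univ_subset_iff.1 (h1.ge.trans (hatImage_mono τ (subset_univ _)))
    -- Since `τ̂` is onto, an image that is everything remains so, and the sum of the exponents
    -- works for all intervals at once.
    have hN : ∀ i : Fin q, (hatImage τ)^[∑ l, k l] (Ioo (b i.castSucc) (b i.succ)) = univ := fun i => by
      obtain ⟨l, hl⟩ := Nat.exists_eq_add_of_le'
        (Finset.single_le_sum (f := k) (fun _ _ => Nat.zero_le _) (Finset.mem_univ i))
      rw [hl, Function.iterate_add_apply, hk i]
      exact Function.iterate_fixed hsurj l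
    refine ⟨hnn, ∑ l, k l, ?_, fun i j => ?_⟩
    · exact (Nat.pos_of_ne_zero (hk0 ⟨0, by omega⟩)).trans_le
        (Finset.single_le_sum (f := k) (fun _ _ => Nat.zero_le _) (Finset.mem_univ _))
    · obtain ⟨y, hy⟩ := exists_between (S.strictMono (Fin.castSucc_lt_succ (i := j)))
      exact S.pow_pos_of_mem_iterate h01 ((hN i).ge (mem_univ y)) hy
  · intro hprim U hU hne
    obtain ⟨k, i, hi⟩ := S.exists_Icc_subset_iterate (branching_of_isIrreducible h01
      hprim.isIrreducible (not_isPermutationMatrix_of_isPrimitive hq hprim)) hU hne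
    obtain ⟨N, -, hN⟩ := hprim.exists_pos_pow
    refine ⟨N + k, univ_subset_iff.1 fun y _ => ?_⟩
    obtain ⟨j, hj⟩ := S.exists_mem_Icc y
    rw [Function.iterate_add_apply]
    exact (hatImage_mono τ).iterate N hi (S.Icc_subset_iterate h01 (hN i j) hj)

theorem isTransitive_of_isIrreducible (S : IsBranchSystem τ C b (fun i j => A i j = 1) m d)
    (h01 : ∀ i j, A i j = 0 ∨ A i j = 1) (hA : A.IsIrreducible)
    (hp : ¬ IsPermutationMatrix A) : IsTransitive τ C := by
  intro U V hU hUne hV hVne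
  obtain ⟨k, i, hi⟩ := S.exists_Icc_subset_iterate (branching_of_isIrreducible h01 hA hp) hU hUne
  obtain ⟨y, hyV, hyC⟩ := S.exists_notMem_orbit hV hVne
  obtain ⟨j, hj⟩ := S.exists_mem_Icc y
  obtain ⟨N, -, hN⟩ := (Matrix.isIrreducible_iff_exists_pow_pos hA.nonneg).1 hA i j
  refine ⟨N + k, y, mem_iterate_partialImage S.hat_eq hyC ?_, hyV⟩
  rw [Function.iterate_add_apply]
  exact (hatImage_mono τ).iterate N hi (S.Icc_subset_iterate h01 hN hj)

theorem isIrreducible_of_isTransitive (S : IsBranchSystem τ C b (fun i j => A i j = 1) m d)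
    (h01 : ∀ i j, A i j = 0 ∨ A i j = 1) (ht : IsTransitive τ C) : A.IsIrreducible := by
  have hnn : ∀ i j, 0 ≤ A i j := fun i j => by rcases h01 i j with h | h <;> simp [h]
  rw [Matrix.isIrreducible_iff_exists_pow_pos hnn]
  choose c hc using fun i : Fin q => exists_between (S.strictMono (Fin.castSucc_lt_succ (i := i)))
  intro i j
  -- Transitivity allows `k = 0`, but irreducibility needs a path of positive length. Taking the
  -- left part of `E_i` and the right part of `E_j` keeps the two sets disjoint even when `i = j`.
  obtain ⟨k, y, hyU, hyV⟩ := ht (Ioo (b i.castSucc) (c i)) (Ioo (c j) (b j.succ)) isOpen_Ioo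
    (exists_between (hc i).1) isOpen_Ioo (exists_between (hc j).2)
  have hyj : y ∈ Ioo (b j.castSucc) (b j.succ) := ⟨(hc j).1.trans hyV.1, hyV.2⟩
  have hsub : Ioo (b i.castSucc) (c i) ⊆ Ioo (b i.castSucc) (b i.succ) :=
    Ioo_subset_Ioo_right (hc i).2.le
  refine ⟨k, Nat.pos_of_ne_zero ?_, S.pow_pos_of_mem_iterate h01 ((hatImage_mono τ).iterate k hsub
    (iterate_partialImage_subset S.hat_eq k _ hyU)) hyj⟩
  rintro rfl
  have hyU : y ∈ Ioo (b i.castSucc) (c i) := hyU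
  obtain rfl := eq_of_mem_Ioo_of_mem_Icc S.strictMono hyj (Ioo_subset_Icc_self (hsub hyU))
  exact lt_asymm hyU.2 hyV.1

theorem mem_Icc_of_unique_successor {R : Fin q → Fin q → Prop}
    (S : IsBranchSystem τ C b R m d) {i j : Fin q}
    (h : ∀ l, R i l → l = j) {x : ℝ} (hx : x ∈ Icc (b i.castSucc : ℝ) (b i.succ)) :
    m i * x + d i j ∈ Icc (b j.castSucc : ℝ) (b j.succ) := by
  have hcl : IsClosed {x : ℝ | m i * x + d i j ∈ Icc (b j.castSucc : ℝ) (b j.succ)} :=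
    isClosed_Icc.preimage (by fun_prop)
  rw [← closure_Ioo (S.cell_lt i).ne] at hx
  refine closure_minimal ?_ hcl (?_ : x ∈ closure (Ioo (b i.castSucc : ℝ) (b i.succ) ∩
    (Subtype.val '' generalizedOrbit τ C)ᶜ))
  · rintro y ⟨hy, hyC⟩
    have hy01 := mem_unitInterval (Ioo_subset_Icc_self hy)
    have hyo : (⟨y, hy01⟩ : unitInterval) ∉ generalizedOrbit τ C := fun h => hyC ⟨_, h, rfl⟩
    obtain ⟨l, hl⟩ := exists_mem_Ioo_of_partition S.first S.last fun h =>
      S.apply_notMem_orbit hyo (S.range_subset_orbit h)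
    have h1 := S.of_mem i l ⟨y, hy01⟩ ⟨hy, fun h => hyo (InGeneralizedOrbit.base h)⟩ hl
    obtain rfl := h l h1.1
    have h2 := Ioo_subset_Icc_self hl
    rw [mem_ofPred_eq]
    rw [← show (τ ⟨y, hy01⟩ : ℝ) = m i * y + d i l from h1.2]
    exact h2
  · have := (S.countable_orbit.image (Subtype.val : unitInterval → ℝ)).dense_compl ℝ
    exact closure_minimal (this.open_subset_closure_inter isOpen_Ioo) isClosed_closure hx

/-- For a permutation matrix each branch maps the closed `E_i` affinely onto the closed `E_{p i}`,
ends to ends, so relative distance to the nearer end is preserved. Points within an eighth of an end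
never reach the part of `E_i` between a quarter and a half. -/
theorem not_isPermutationMatrix_of_isTransitive
    (S : IsBranchSystem τ C b (fun i j => A i j = 1) m d) (ht : IsTransitive τ C) :
    ¬ IsPermutationMatrix A := by
  rintro ⟨p, rfl⟩
  have hp : ∀ i j, p.permMatrix ℤ i j = 1 ↔ p i = j := fun i j => by
    rw [permMatrix_apply_eq_ite]
    split_ifs <;> simp_all
  set near : Fin q → unitInterval → Prop := fun i x =>
    8 * ((x : ℝ) - b i.castSucc) < b i.succ - b i.castSucc ∨
      8 * ((b i.succ : ℝ) - x) < b i.succ - b i.castSucc with hnear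
  have hstep : ∀ i (x y : unitInterval), near i x →
      (y : ℝ) = m i * x + d i (p i) → near (p i) y := by
    intro i x y hx hy
    have h1 := S.mem_Icc_of_unique_successor (j := p i) (fun l hl => ((hp i l).1 hl).symm)
      (left_mem_Icc.2 (S.cell_lt i).le)
    have h2 := S.mem_Icc_of_unique_successor (j := p i) (fun l hl => ((hp i l).1 hl).symm)
      (right_mem_Icc.2 (S.cell_lt i).le)
    have h3 := S.length_le ((hp i (p i)).2 rfl)
    have hlt := S.cell_lt i
    simp only [hnear] at hx ⊢
    rcases (S.slope_ne i).lt_or_gt with hm | hm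
    · rw [abs_of_neg hm] at h3
      -- A negative slope exchanges the two ends.
      refine hx.symm.imp (fun h => ?_) (fun h => ?_)
      all_goals
        rw [hy]
        nlinarith [h1.1, h1.2, h2.1, h2.2, mul_lt_mul_of_neg_left h hm]
    · rw [abs_of_pos hm] at h3
      refine hx.imp (fun h => ?_) (fun h => ?_)
      all_goals
        rw [hy]
        nlinarith [h1.1, h1.2, h2.1, h2.2, mul_lt_mul_of_pos_left h hm]
  obtain ⟨i, -⟩ := S.exists_mem_Icc 0
  have hlt := S.cell_lt i
  have hi0 := (b i.castSucc).2.1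
  have hi1 := (b i.succ).2.2
  set U : Set unitInterval := Subtype.val ⁻¹'
    Ioo (b i.castSucc : ℝ) (b i.castSucc + (b i.succ - b i.castSucc) / 8)
  set V : Set unitInterval := Subtype.val ⁻¹'
    Ioo (b i.castSucc + (b i.succ - b i.castSucc) / 4 : ℝ)
      (b i.castSucc + (b i.succ - b i.castSucc) / 2)
  have hinv : ∀ k, ∀ y ∈ (partialImage τ C)^[k] U, y ∉ range b →
      ∃ j, y ∈ Ioo (b j.castSucc) (b j.succ) ∧ near j y := by
    intro k
    induction k with
    | zero =>
      intro y (hy : y ∈ U) _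
      have hy1 : (b i.castSucc : ℝ) < y := hy.1
      have hy2 : (y : ℝ) < b i.castSucc + (b i.succ - b i.castSucc) / 8 := hy.2
      refine ⟨i, ⟨hy1, show (y : ℝ) < b i.succ by linarith⟩, Or.inl (by linarith)⟩
    | succ k ih =>
      intro y hy hyB
      rw [Function.iterate_succ_apply'] at hy
      obtain ⟨x, ⟨hx, hxC⟩, rfl⟩ := hy
      obtain ⟨l, hxl, hnl⟩ := ih x hx fun h =>
        hyB (S.hat_subset_range h (by rw [S.hat_eq x hxC]; rfl))
      obtain ⟨j, hj⟩ := exists_mem_Ioo_of_partition S.first S.last hyB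
      obtain ⟨hR, heq⟩ := S.of_mem l j x ⟨hxl, hxC⟩ hj
      obtain rfl := (hp l j).1 hR
      exact ⟨p l, hj, hstep l x _ hnl heq⟩
  obtain ⟨k, y, hyU, hyV⟩ := ht U V (isOpen_Ioo.preimage continuous_subtype_val)
    ⟨⟨b i.castSucc + (b i.succ - b i.castSucc) / 16, by linarith, by linarith⟩,
      show _ < _ by dsimp only; linarith, show _ < _ by dsimp only; linarith⟩
    (isOpen_Ioo.preimage continuous_subtype_val)
    ⟨⟨b i.castSucc + 3 * (b i.succ - b i.castSucc) / 8, by linarith, by linarith⟩,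
      show _ < _ by dsimp only; linarith, show _ < _ by dsimp only; linarith⟩
  have hy1 : (b i.castSucc + (b i.succ - b i.castSucc) / 4 : ℝ) < y := hyV.1
  have hy2 : (y : ℝ) < b i.castSucc + (b i.succ - b i.castSucc) / 2 := hyV.2
  have hyi : y ∈ Ioo (b i.castSucc) (b i.succ) :=
    ⟨show (b i.castSucc : ℝ) < y by linarith, show (y : ℝ) < b i.succ by linarith⟩
  obtain ⟨j, hj, hn⟩ := hinv k y hyU (notMem_range_of_mem_Ioo S.strictMono hyi)
  obtain rfl := eq_of_mem_Ioo_of_mem_Icc S.strictMono hyi (Ioo_subset_Icc_self hj)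
  rcases hn with h | h <;> linarith

end IsBranchSystem

/-! ### The order topology of the disconnected interval -/

namespace Disconnection

variable {S : Set unitInterval}

/-- Whether a point is the right-hand copy `x⁺` of a split point. -/
def isRight (x : Disconnection S) : Bool :=
  (ofLex x.1).2

theorem ext_collapse {x y : Disconnection S} (h : collapse x = collapse y)
    (h' : isRight x = isRight y) : x = y :=
  Subtype.ext (congrArg toLex (Prod.ext h h'))

theorem mem_of_isRight {x : Disconnection S} (h : isRight x = true) : collapse x ∈ S \ {0, 1} :=
  x.2 h

theorem lt_iff {x y : Disconnection S} : x < y ↔ collapse x < collapse y ∨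
    collapse x = collapse y ∧ isRight x = false ∧ isRight y = true := by
  have h : x < y ↔ x.1 < y.1 := Iff.rfl
  rw [h, Prod.Lex.lt_iff, Bool.lt_iff]
  rfl

theorem exists_collapse (x : unitInterval) :
    ∃ z : Disconnection S, collapse z = x ∧ isRight z = false :=
  ⟨⟨toLex (x, false), fun h => absurd h Bool.false_ne_true⟩, rfl, rfl⟩

theorem exists_isRight {x : unitInterval} (hx : x ∈ S \ {0, 1}) :
    ∃ z : Disconnection S, collapse z = x ∧ isRight z = true :=
  ⟨⟨toLex (x, true), fun _ => hx⟩, rfl, rfl⟩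

theorem isRight_eq_false {x : Disconnection S} (h : collapse x ∉ S) : isRight x = false := by
  by_contra hx
  exact h (mem_of_isRight (by simpa using hx)).1

/-- A right-hand copy, or `0`, is approached from the right; every other point from the left. On
that side no point has the same collapse. -/
theorem dense_setOf_collapse_notMem
    (hS : ∀ x y : unitInterval, x < y → ∃ z ∈ Ioo x y, z ∉ S) :
    Dense {x : Disconnection S | collapse x ∉ S} := by
  have key : ∀ x y : Disconnection S, collapse x < collapse y →
      ∃ z ∈ Ioo x y, collapse z ∉ S := by
    intro x y hxy
    obtain ⟨w, hw, hwS⟩ := hS _ _ hxy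
    obtain ⟨z, hz, -⟩ := exists_collapse (S := S) w
    exact ⟨z, ⟨lt_iff.2 (Or.inl (hz ▸ hw.1)), lt_iff.2 (Or.inl (hz ▸ hw.2))⟩, hz ▸ hwS⟩
  intro x
  rw [mem_closure_iff]
  intro U hU hxU
  have hright : (∀ y, x < y → collapse x < collapse y) → (∃ y, x < y) →
      (U ∩ {x | collapse x ∉ S}).Nonempty := by
    intro h hy
    obtain ⟨y, hxy, hs⟩ := exists_Ico_subset_of_mem_nhds (hU.mem_nhds hxU) hy
    obtain ⟨z, hz, hzS⟩ := key x y (h y hxy)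
    exact ⟨z, hs ⟨hz.1.le, hz.2⟩, hzS⟩
  obtain ⟨t, ht, -⟩ := exists_collapse (S := S) 1
  obtain ⟨e, he, -⟩ := exists_collapse (S := S) 0
  by_cases hx : isRight x = true
  · refine hright (fun y hy => ?_) ⟨t, lt_iff.2 (Or.inl ?_)⟩
    · exact (lt_iff.1 hy).resolve_right fun h => by simp [hx] at h
    · have := (mem_of_isRight hx).2
      rw [ht]
      exact lt_of_le_of_ne unitInterval.le_one' fun h => this (Or.inr h)
  · by_cases h0 : collapse x = 0
    · refine hright (fun y hy => ?_) ⟨t, lt_iff.2 (Or.inl ?_)⟩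
      · exact (lt_iff.1 hy).resolve_right fun h =>
          (mem_of_isRight h.2.2).2 (Or.inl (h.1 ▸ h0))
      · rw [ht, h0]; exact zero_lt_one
    · have hex : e < x := lt_iff.2 (Or.inl (by
        rw [he]; exact lt_of_le_of_ne unitInterval.nonneg' (Ne.symm h0)))
      obtain ⟨y, hyx, hs⟩ := exists_Ioc_subset_of_mem_nhds (hU.mem_nhds hxU) ⟨e, hex⟩
      obtain ⟨z, hz, hzS⟩ := key y x ((lt_iff.1 hyx).resolve_right fun h => hx h.2.2)
      exact ⟨z, hs ⟨hz.1, hz.2.le⟩, hzS⟩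

end Disconnection

/-! ### The shift space and the coding conjugacy -/

theorem isCompact_shiftSpace {q : ℕ} (A : Matrix (Fin q) (Fin q) ℤ) :
    CompactSpace (ShiftSpace A) := by
  have h : IsClosed {x : ℕ → Fin q | ∀ k, A (x k) (x (k + 1)) = 1} := by
    have he : {x : ℕ → Fin q | ∀ k, A (x k) (x (k + 1)) = 1} =
        ⋂ k, (fun x : ℕ → Fin q => (x k, x (k + 1))) ⁻¹' {z | A z.1 z.2 = 1} := by
      ext x
      simp
    rw [he]
    exact isClosed_iInter fun k => (isClosed_discrete _).preimage (by fun_prop)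
  exact isCompact_iff_compactSpace.1 h.isCompact

theorem continuous_shift {q : ℕ} (A : Matrix (Fin q) (Fin q) ℤ) : Continuous (shift A) :=
  Continuous.subtype_mk (f := fun (x : ShiftSpace A) k => x.1 (k + 1)) (continuous_pi fun k =>
    (continuous_apply (k + 1)).comp continuous_subtype_val) _

theorem eventually_prefix_eq {q : ℕ} {A : Matrix (Fin q) (Fin q) ℤ} (s : ShiftSpace A) (k : ℕ) :
    ∀ᶠ t in 𝓝 s, ∀ l ≤ k, t.1 l = s.1 l := by
  have h : ∀ l, ∀ᶠ t in 𝓝 s, t.1 l = s.1 l := fun l =>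
    ((continuous_apply l).comp continuous_subtype_val).continuousAt.eventually
      (by simp : ∀ᶠ y in 𝓝 (s.1 l), y = s.1 l)
  have := (Finset.range (k + 1)).eventually_all.2 fun l _ => h l
  filter_upwards [this] with t ht l hl
  exact ht l (by simp; omega)

theorem exists_mem_orbit_of_mem_iterate {τ : unitInterval → unitInterval} {C U : Set unitInterval}
    {k : ℕ} {y : unitInterval} (hy : y ∈ generalizedOrbit τ C) (hU : y ∈ (hatImage τ)^[k] U) :
    ∃ x ∈ U, x ∈ generalizedOrbit τ C := by
  induction k generalizing y with
  | zero => exact ⟨y, hU, hy⟩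
  | succ k ih =>
    rw [Function.iterate_succ_apply'] at hU
    obtain ⟨x, hx, hxy⟩ := mem_hatImage.1 hU
    exact ih (InGeneralizedOrbit.preimage hy hxy) hx

namespace IsBranchSystem

variable {τ : unitInterval → unitInterval} {C : Set unitInterval} {q : ℕ}
  {b : Fin (q + 1) → unitInterval} {R : Fin q → Fin q → Prop} {m : Fin q → ℝ}
  {d : Fin q → Fin q → ℝ}

/-- An end of a cylinder is carried to an end of a Markov interval, which lies in the orbit, and the
orbit is closed under preimages. -/
theorem mem_orbit_of_isLeast_or_isGreatest (S : IsBranchSystem τ C b R m d) {s : ℕ → Fin q}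
    (hs : ∀ k, R (s k) (s (k + 1))) {k : ℕ} {x : unitInterval}
    (hx : IsLeast (cylinder b m d s k) x ∨ IsGreatest (cylinder b m d s k) x) :
    x ∈ generalizedOrbit τ C := by
  obtain ⟨p, r, hpr, hIoo, hIcc, -⟩ := S.cylinder_interval s k
  have hxc : (x : ℝ) ∈ cylinder b m d s k := hx.elim (fun h => h.1) fun h => h.1
  have hxe : (x : ℝ) ∉ Ioo p r := by
    rw [hIcc] at hx
    rintro ⟨h1, h2⟩
    rcases hx with hx | hx
    · exact absurd (hx.2 (left_mem_Icc.2 hpr.le)) (not_le.2 h1)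
    · exact absurd (hx.2 (right_mem_Icc.2 hpr.le)) (not_le.2 h2)
  rw [← hIoo] at hxe
  have hy01 := mem_unitInterval hxc
  set y : unitInterval := ⟨forward m d s k x, hy01⟩
  have hy : y ∈ Icc (b (s k).castSucc) (b (s k).succ) := hxc
  have hyo : y ∈ generalizedOrbit τ C := by
    rcases hy.1.eq_or_lt with h | h
    · exact h ▸ S.mem_orbit _
    rcases hy.2.eq_or_lt with h' | h'
    · exact h' ▸ S.mem_orbit _
    exact absurd ⟨h, h'⟩ hxe
  obtain ⟨_, rfl, hz⟩ := exists_mem_orbit_of_mem_iterate hyo (S.mem_iterate_hatImage hs rfl hy)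
  exact hz

/-- Iterates of an orbit point eventually fall into `range b`, hence on the ends of the Markov
intervals; this is where `eventually_mem` enters the coding. -/
theorem exists_isLeast_or_isGreatest (S : IsBranchSystem τ C b R m d) {s : ℕ → Fin q}
    (hs : ∀ k, R (s k) (s (k + 1))) {x : unitInterval} (hx : Codes b m d s x)
    (hxo : x ∈ generalizedOrbit τ C) :
    ∃ k, IsLeast (cylinder b m d s k) x ∨ IsGreatest (cylinder b m d s k) x := by
  obtain ⟨k, hk⟩ := S.eventually_mem x hxo
  refine ⟨k, ?_⟩
  obtain ⟨p, r, hpr, hIoo, hIcc, -⟩ := S.cylinder_interval s k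
  have hxc := hx k
  have hy : (⟨forward m d s k x, mem_unitInterval hxc⟩ : unitInterval) ∈ range b :=
    hk (S.mem_iterate_hatImage hs rfl hxc)
  have hxe : (x : ℝ) ∉ Ioo p r := fun h =>
    notMem_range_of_mem_Ioo S.strictMono (i := s k) ((hIoo _).2 h) hy
  rw [hIcc] at hxc ⊢
  rcases hxc.1.eq_or_lt with h | h
  · exact Or.inl (by rw [← h]; exact isLeast_Icc hpr.le)
  rcases hxc.2.eq_or_lt with h' | h'
  · exact Or.inr (by rw [h']; exact isGreatest_Icc hpr.le)
  exact absurd ⟨h, h'⟩ hxe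

theorem not_isLeast_of_isGreatest (S : IsBranchSystem τ C b R m d) {s : ℕ → Fin q}
    (hs : ∀ k, R (s k) (s (k + 1))) {k l : ℕ} {x : ℝ}
    (hk : IsGreatest (cylinder b m d s k) x) : ¬ IsLeast (cylinder b m d s l) x := fun hl => by
  obtain ⟨p, r, hpr, -, hIcc, -⟩ := S.cylinder_interval s (max k l)
  have hp : p ∈ cylinder b m d s (max k l) := by rw [hIcc]; exact left_mem_Icc.2 hpr.le
  have hr : r ∈ cylinder b m d s (max k l) := by rw [hIcc]; exact right_mem_Icc.2 hpr.le
  have h1 := hk.2 (S.cylinder_antitone hs (le_max_left k l) hr)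
  have h2 := hl.2 (S.cylinder_antitone hs (le_max_right k l) hp)
  linarith

/-- `z` is the point of the disconnected space whose itinerary is `s`. -/
structure Lifts (τ : unitInterval → unitInterval) (C : Set unitInterval)
    (b : Fin (q + 1) → unitInterval) (m : Fin q → ℝ) (d : Fin q → Fin q → ℝ) (s : ℕ → Fin q)
    (z : DisconnectedSpace τ C) : Prop where
  codes : Codes b m d s (collapse z)
  isRight_iff : Disconnection.isRight z = true ↔
    collapse z ≠ 0 ∧ ∃ k, IsLeast (cylinder b m d s k) (collapse z)

/-- When `x` is the left end of a cylinder, the later cylinders lie to its right, which selects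
`x⁺`. The point `0` is not split, and `1` is never a left end. -/
theorem exists_lifts (S : IsBranchSystem τ C b R m d) {s : ℕ → Fin q}
    (hs : ∀ k, R (s k) (s (k + 1))) : ∃ z, Lifts τ C b m d s z := by
  obtain ⟨x, hx⟩ := S.exists_codes hs
  have hx01 := S.cylinder_subset_unitInterval hs 0 (hx 0)
  lift x to unitInterval using hx01
  by_cases h : x ≠ 0 ∧ ∃ k, IsLeast (cylinder b m d s k) x
  · obtain ⟨h0, k, hk⟩ := h
    have h1 : x ≠ 1 := by
      rintro rfl
      obtain ⟨p, r, hpr, -, hIcc, -⟩ := S.cylinder_interval s k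
      have hr : r ∈ cylinder b m d s k := by rw [hIcc]; exact right_mem_Icc.2 hpr.le
      have hp : p ∈ cylinder b m d s k := by rw [hIcc]; exact left_mem_Icc.2 hpr.le
      have hp' : ((1 : unitInterval) : ℝ) ≤ p := hk.2 hp
      have hr' := (S.cylinder_subset_unitInterval hs k hr).2
      rw [Icc.coe_one] at hp'
      linarith
    have hxS : x ∈ generalizedOrbit τ C \ {0, 1} :=
      ⟨S.mem_orbit_of_isLeast_or_isGreatest hs (Or.inl hk), by simp [h0, h1]⟩
    obtain ⟨z, hz, hzr⟩ := Disconnection.exists_isRight hxS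
    subst hz
    exact ⟨z, hx, iff_of_true hzr ⟨h0, k, hk⟩⟩
  · obtain ⟨z, hz, hzr⟩ := Disconnection.exists_collapse (S := generalizedOrbit τ C) x
    subst hz
    exact ⟨z, hx, iff_of_false (by simp [hzr]) h⟩

/-- Where the sequences differ, the two cylinders have disjoint interiors, so a shared point is the
right end of one and the left end of the other; one lift is then `x⁻` and the other `x⁺`. -/
theorem lifts_injective (S : IsBranchSystem τ C b R m d) {s t : ℕ → Fin q}
    (hs : ∀ k, R (s k) (s (k + 1))) (ht : ∀ k, R (t k) (t (k + 1))) {z : DisconnectedSpace τ C}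
    (hz : Lifts τ C b m d s z) (hz' : Lifts τ C b m d t z) : s = t := by
  by_contra hne
  obtain ⟨k, hk⟩ := Function.ne_iff.1 hne
  have key : ∀ s t : ℕ → Fin q, (∀ k, R (s k) (s (k + 1))) → (∀ k, R (t k) (t (k + 1))) →
      Lifts τ C b m d s z → Lifts τ C b m d t z → ∀ p r p' r', p < r → p' < r' →
      cylinder b m d s k = Icc p r → cylinder b m d t k = Icc p' r' → r ≤ p' → False := by
    intro s t hs ht hz hz' p r p' r' hpr hpr' hc hc' hle
    have h1 := hz.codes k
    have h2 := hz'.codes k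
    have hp : p ∈ cylinder b m d s k := by rw [hc]; exact left_mem_Icc.2 hpr.le
    have hp0 := (S.cylinder_subset_unitInterval hs k hp).1
    rw [hc] at h1
    rw [hc'] at h2
    have e1 : (collapse z : ℝ) = r := le_antisymm h1.2 (hle.trans h2.1)
    have e2 : (collapse z : ℝ) = p' := le_antisymm (h1.2.trans hle) h2.1
    have g1 : IsGreatest (cylinder b m d s k) (collapse z) := by
      rw [hc, e1]; exact isGreatest_Icc hpr.le
    have g2 : IsLeast (cylinder b m d t k) (collapse z) := by
      rw [hc', e2]; exact isLeast_Icc hpr'.le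
    have h0 : collapse z ≠ 0 := fun h => by
      rw [h, Icc.coe_zero] at e1
      linarith
    obtain ⟨-, l, hl⟩ := hz.isRight_iff.1 (hz'.isRight_iff.2 ⟨h0, k, g2⟩)
    exact S.not_isLeast_of_isGreatest hs g1 hl
  obtain ⟨p, r, hpr, hIoo, hIcc, -⟩ := S.cylinder_interval s k
  obtain ⟨p', r', hpr', hIoo', hIcc', -⟩ := S.cylinder_interval t k
  have hp : p ∈ cylinder b m d s k := by rw [hIcc]; exact left_mem_Icc.2 hpr.le
  have hr : r ∈ cylinder b m d s k := by rw [hIcc]; exact right_mem_Icc.2 hpr.le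
  rcases S.disjoint_interiors hs ht hk hpr hpr' hIoo hIoo'
    (S.cylinder_subset_unitInterval hs k hp).1 (S.cylinder_subset_unitInterval hs k hr).2
    with h | h
  · exact key s t hs ht hz hz' p r p' r' hpr hpr' hIcc hIcc' h
  · exact key t s ht hs hz' hz p' r' p r hpr' hpr hIcc' hIcc h

variable {A : Matrix (Fin q) (Fin q) ℤ}

/-- It suffices to test open rays. Strict inequalities between collapses persist because cylinders
are small. At a split point, a long common prefix puts nearby sequences in a cylinder having that
point as an end, so their lifts stay on the same side. -/
theorem continuous_lift (S : IsBranchSystem τ C b (fun i j => A i j = 1) m d)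
    (hR : Branching fun i j => A i j = 1) {g : ShiftSpace A → DisconnectedSpace τ C}
    (hg : ∀ s, Lifts τ C b m d s.1 (g s)) : Continuous g := by
  have hnear : ∀ s : ShiftSpace A, ∀ ε > 0, ∀ᶠ t in 𝓝 s,
      |(collapse (g t) : ℝ) - collapse (g s)| < ε := by
    intro s ε hε
    obtain ⟨k, hk⟩ := S.exists_cylinder_small hR s.2 hε
    filter_upwards [eventually_prefix_eq s k] with t ht
    refine hk _ ?_ _ ((hg s).codes k)
    rw [← cylinder_congr ht]
    exact (hg t).codes k
  refine OrderTopology.continuous_iff.2 fun z => ⟨?_, ?_⟩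
  · refine isOpen_iff_mem_nhds.2 fun s (hs : z < g s) => ?_
    rcases Disconnection.lt_iff.1 hs with h | ⟨h, hz, hgs⟩
    · have h' : (collapse z : ℝ) < collapse (g s) := h
      filter_upwards [hnear s _ (sub_pos.2 h')] with t ht
      refine Disconnection.lt_iff.2 (Or.inl ?_)
      rw [abs_lt] at ht
      have : (collapse z : ℝ) < collapse (g t) := by linarith [ht.1]
      exact this
    · obtain ⟨h0, k, hk⟩ := (hg s).isRight_iff.1 hgs
      filter_upwards [eventually_prefix_eq s k] with t ht
      have hc := cylinder_congr (b := b) (m := m) (d := d) ht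
      have hle : (collapse (g s) : ℝ) ≤ collapse (g t) := hk.2 (hc ▸ (hg t).codes k)
      refine Disconnection.lt_iff.2 ?_
      rw [h]
      refine (lt_or_eq_of_le (show collapse (g s) ≤ collapse (g t) from hle)).imp_right
        fun he => ⟨he, hz, (hg t).isRight_iff.2 ⟨he ▸ h0, k, ?_⟩⟩
      rw [hc, ← he]
      exact hk
  · refine isOpen_iff_mem_nhds.2 fun s (hs : g s < z) => ?_
    rcases Disconnection.lt_iff.1 hs with h | ⟨h, hgs, hz⟩
    · have h' : (collapse (g s) : ℝ) < collapse z := h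
      filter_upwards [hnear s _ (sub_pos.2 h')] with t ht
      refine Disconnection.lt_iff.2 (Or.inl ?_)
      rw [abs_lt] at ht
      have : (collapse (g t) : ℝ) < collapse z := by linarith [ht.2]
      exact this
    · have hzS := Disconnection.mem_of_isRight hz
      rw [← h] at hzS
      obtain ⟨k, hk⟩ := S.exists_isLeast_or_isGreatest s.2 (hg s).codes hzS.1
      have hk : IsGreatest (cylinder b m d s.1 k) (collapse (g s)) := hk.resolve_left fun hk => by
        rw [(hg s).isRight_iff.2 ⟨fun h => hzS.2 (Or.inl h), k, hk⟩] at hgs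
        exact absurd hgs (by simp)
      filter_upwards [eventually_prefix_eq s k] with t ht
      have hc := cylinder_congr (b := b) (m := m) (d := d) ht
      have hle : (collapse (g t) : ℝ) ≤ collapse (g s) := hk.2 (hc ▸ (hg t).codes k)
      refine Disconnection.lt_iff.2 ?_
      rw [← h]
      refine (lt_or_eq_of_le (show collapse (g t) ≤ collapse (g s) from hle)).imp_right
        fun he => ⟨he, ?_, hz⟩
      by_contra hr
      obtain ⟨-, l, hl⟩ := (hg t).isRight_iff.1 (by simpa using hr)
      rw [← he, ← hc] at hk
      exact S.not_isLeast_of_isGreatest t.2 hk hl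

theorem dense_setOf_collapse_notMem (S : IsBranchSystem τ C b R m d) :
    Dense {x : DisconnectedSpace τ C | collapse x ∉ generalizedOrbit τ C} :=
  Disconnection.dense_setOf_collapse_notMem fun _ _ hxy =>
    S.exists_notMem_orbit isOpen_Ioo (exists_between hxy)

theorem isAssociatedMap_unique (S : IsBranchSystem τ C b R m d)
    {σ σ' : DisconnectedSpace τ C → DisconnectedSpace τ C} (h : IsAssociatedMap τ C σ)
    (h' : IsAssociatedMap τ C σ') : σ = σ' := by
  refine Continuous.ext_on S.dense_setOf_collapse_notMem h.1 h'.1 fun x hx => ?_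
  have h1 := h.2 x hx
  have h2 := h'.2 x hx
  have ho := S.apply_notMem_orbit hx
  refine Disconnection.ext_collapse (h1.trans h2.symm) ?_
  rw [Disconnection.isRight_eq_false (h1 ▸ ho), Disconnection.isRight_eq_false (h2 ▸ ho)]

theorem exists_conjugacy (S : IsBranchSystem τ C b (fun i j => A i j = 1) m d)
    (hR : Branching fun i j => A i j = 1) :
    ∃ σ : DisconnectedSpace τ C → DisconnectedSpace τ C, IsAssociatedMap τ C σ ∧
      AreConjugate σ (shift A) := by
  choose g hg using fun s : ShiftSpace A => S.exists_lifts s.2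
  have hcont := S.continuous_lift hR hg
  have := isCompact_shiftSpace A
  have hinj : Function.Injective g := fun s t hst =>
    Subtype.ext (S.lifts_injective s.2 t.2 (hg s) (hst ▸ hg t))
  have hrange : {x : DisconnectedSpace τ C | collapse x ∉ generalizedOrbit τ C} ⊆ range g := by
    intro z hz
    obtain ⟨s, hs, hc⟩ := S.exists_itinerary hz
    have he : collapse (g ⟨s, hs⟩) = collapse z :=
      Subtype.ext (S.codes_unique hR hs (hg ⟨s, hs⟩).codes hc)
    refine ⟨⟨s, hs⟩, Disconnection.ext_collapse he ?_⟩
    rw [Disconnection.isRight_eq_false hz, Disconnection.isRight_eq_false (he ▸ hz)]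
  -- The range is compact, hence closed, and contains the dense set of points off the orbit.
  have hsurj : Function.Surjective g := by
    rw [← range_eq_univ, ← (isCompact_range hcont).isClosed.closure_eq]
    exact (S.dense_setOf_collapse_notMem.mono hrange).closure_eq
  set e : ShiftSpace A ≃ₜ DisconnectedSpace τ C :=
    Continuous.homeoOfEquivCompactToT2 (f := Equiv.ofBijective g ⟨hinj, hsurj⟩) hcont
  have he : ∀ s, e s = g s := fun _ => rfl
  refine ⟨fun z => e (shift A (e.symm z)),
    ⟨e.continuous.comp ((continuous_shift A).comp e.symm.continuous), fun z hz => ?_⟩,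
    e.symm, fun z => e.symm_apply_apply _⟩
  obtain ⟨s, rfl⟩ := e.surjective z
  change collapse (e (shift A (e.symm (e s)))) = τ (collapse (e s))
  rw [e.symm_apply_apply, he, he]
  rw [he] at hz
  have hs0 : A (s.1 0) (s.1 1) = 1 := s.2 0
  -- The shifted sequence codes the image of the point under its branch, and off the orbit this
  -- image can only be its value under `τ`.
  have hxy := S.codes_unique hR (shift A s).2 (hg (shift A s)).codes (hg s).codes.shift
  have hmem := S.mem_hat hs0 ((hg (shift A s)).codes 0) hxy
  rw [S.hat_eq _ fun h => hz (InGeneralizedOrbit.base h)] at hmem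
  exact hmem

end IsBranchSystem

end IntervalMap

theorem corollary1p86 (τ : unitInterval → unitInterval) (n q : ℕ)
    (a : Fin (n + 1) → unitInterval) (b : Fin (q + 1) → unitInterval)
    (hτ : IntervalMap.IsPiecewiseMonotonic τ a)
    (hb : IntervalMap.IsMarkovPartition τ (Set.range a) b)
    (hlin : IntervalMap.IsPiecewiseLinear τ a b)
    (A : Matrix (Fin q) (Fin q) ℤ) (hA : A = IntervalMap.incidenceMatrix τ b) :
    (2 ≤ q → (IntervalMap.IsTopologicallyExact τ ↔ A.IsPrimitive)) ∧
    (IntervalMap.IsTransitive τ (Set.range a) ↔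
      A.IsIrreducible ∧ ¬ IntervalMap.IsPermutationMatrix A) ∧
    (A.IsIrreducible ∧ ¬ IntervalMap.IsPermutationMatrix A →
      (∃! σ : IntervalMap.DisconnectedSpace τ (Set.range a) →
          IntervalMap.DisconnectedSpace τ (Set.range a),
        IntervalMap.IsAssociatedMap τ (Set.range a) σ) ∧
      ∀ σ : IntervalMap.DisconnectedSpace τ (Set.range a) →
          IntervalMap.DisconnectedSpace τ (Set.range a),
        IntervalMap.IsAssociatedMap τ (Set.range a) σ →
          IntervalMap.AreConjugate σ (IntervalMap.shift A)) := by
  obtain ⟨m, d, S⟩ := IntervalMap.exists_isBranchSystem hτ hb hlin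
  have hR : IntervalMap.Covers τ (Set.range a) b = fun i j => A i j = 1 := by
    funext i j
    rw [hA, IntervalMap.incidenceMatrix_eq_one_iff, S.rel_iff]
  rw [hR] at S
  have h01 : ∀ i j, A i j = 0 ∨ A i j = 1 := hA ▸ IntervalMap.incidenceMatrix_eq_zero_or_one τ b
  refine ⟨S.isTopologicallyExact_iff h01,
    ⟨fun h => ⟨S.isIrreducible_of_isTransitive h01 h, S.not_isPermutationMatrix_of_isTransitive h⟩,
      fun h => S.isTransitive_of_isIrreducible h01 h.1 h.2⟩, fun h => ?_⟩
  obtain ⟨σ, hσ, hconj⟩ :=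
    S.exists_conjugacy (IntervalMap.branching_of_isIrreducible h01 h.1 h.2)
  exact ⟨⟨σ, hσ, fun σ' hσ' => S.isAssociatedMap_unique hσ' hσ⟩,
    fun σ' hσ' => S.isAssociatedMap_unique hσ hσ' ▸ hconj⟩
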